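/- Let $R$ be a finite associative ring with unit, $1 \ne 0$, not necessarily commutative, with unit group $R^*$. Let $H=\{(x,y)\in R^2 : xy=1\}$. For a character $\psi$ of the additive group $R^2$ put $\hat H(\psi)=|R|^{-2}\sum_{h\in H}\psi(-h)$. The Kloosterman–Salem number $C_R$ is the infimum of the $C>0$ such that $|\hat H(\psi)|\le C|R|^{-2}|R^*|^{1/2}$ for all nontrivial $\psi$; $R$ is called extremal if $C_R=\sqrt{|R^*|}$. The hyperbola graph of $R$ has vertex set $R^2$, with $x$ adjacent to $y$ iff $x-y\in H$. Its spectrum is the collection of eigenvalues of its adjacency matrix, with multiplicity, and its spectral gap is the largest eigenvalue minus the second largest magnitude of an eigenvalue (counted with multiplicity). Then: 1. The hyperbola graph is regular of degree $|R^*|$. It is connected and not bipartite if and only if $C_R<\sqrt{|R^*|}$, i.e. if and only if $R$ is not extremal. 2. The spectrum of the hyperbola graph consists exactly of the numbers $|R|^2\hat H(\psi)$, where $\psi$ runs over all characters of $R^2$ (with multiplicity). 3. If $R$ is not extremal, the spectral gap of the hyperbola graph is $|R^*|-C_R\sqrt{|R^*|}$. 4. If $R$ is not extremal, the uniform random walk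 on the hyperbola graph converges to the uniform distribution: for all vertices $i,j$, the probability $p_{ij}^t$ that the walk started at $i$ is at $j$ after $t$ steps tends to $1/|R|^2$ as $t\to\infty$, and for every $t\ge 0$ $$\left|p_{ij}^t-\frac1{|R|^2}\right|\le\left(\frac{C_R}{\sqrt{|R^*|}}\right)^t .$$ 5. The independence number of the hyperbola graph is at most $C_R|R|^2|R^*|^{-1/2}$. 6. The chromatic number of the hyperbola graph is at least $|R^*|^{1/2}/C_R$. 7. If $R$ is a field of order $q$, the chromatic number of the hyperbola graph is at least $\frac{1}{2.14}\sqrt{q-1}$. -/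

import Mathlib

open Filter Topology

noncomputable section

/-- The hyperbola `H = {(x, y) ∈ R² : x y = 1}` of a ring `R`. -/
def hyperbola (R : Type*) [Ring R] : Set (R × R) := {p | p.1 * p.2 = 1}

/-- The Fourier coefficient, at a character `ψ` of the finite abelian group `A`, of the
characteristic function of `S ⊆ A`, for the Haar measure of total mass `1` on `A`:
`Ŝ(ψ) = |A|⁻¹ ∑ x, 1_S(x) ψ(-x)`. The additive characters `A → ℂ` form the Pontryagin dual. -/
def setFourierCoeff {A : Type*} [AddCommGroup A] [Fintype A] (S : Set A) (ψ : AddChar A ℂ) : ℂ :=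
  (Nat.card A : ℂ)⁻¹ * ∑ x : A, S.indicator (fun _ => (1 : ℂ)) x * ψ (-x)

/-- The Kloosterman-Salem number `C_R` of a finite ring `R`: the infimum of the `C > 0` with
`|Ĥ(ψ)| ≤ C |R|⁻² |R*|^(1/2)` for all nontrivial characters `ψ` of `R²`. -/
def kloostermanSalem (R : Type*) [Ring R] [Fintype R] : ℝ :=
  sInf {C : ℝ | 0 < C ∧ ∀ ψ : AddChar (R × R) ℂ, ψ ≠ 1 →
    ‖setFourierCoeff (hyperbola R) ψ‖ ≤ C * ((Nat.card R : ℝ) ^ 2)⁻¹ * √(Nat.card Rˣ : ℝ)}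

/-- A finite ring is extremal if `C_R = |R*|^(1/2)`. -/
def IsExtremalRing (R : Type*) [Ring R] [Fintype R] : Prop :=
  kloostermanSalem R = √(Nat.card Rˣ : ℝ)

/-- The hyperbola graph: vertex set `R²`, with `x` adjacent to `y` iff `x - y ∈ H`. -/
def hyperbolaGraph (R : Type*) [Ring R] [Nontrivial R] : SimpleGraph (R × R) where
  Adj x y := x - y ∈ hyperbola R
  symm := ⟨fun x y h => by
    have h' : (x.1 - y.1) * (x.2 - y.2) = 1 := h
    show (y.1 - x.1) * (y.2 - x.2) = 1
    rw [← neg_sub x.1, ← neg_sub x.2, neg_mul_neg, h']⟩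
  loopless := ⟨fun x h => by
    have h' : (x.1 - x.1) * (x.2 - x.2) = 1 := h
    simp at h'⟩

instance (R : Type*) [Ring R] [Nontrivial R] [DecidableEq R] :
    DecidableRel (hyperbolaGraph R).Adj :=
  fun x y => inferInstanceAs (Decidable ((x.1 - y.1) * (x.2 - y.2) = 1))

section Graph

variable {V : Type*} [Fintype V] [DecidableEq V] (G : SimpleGraph V) [DecidableRel G.Adj]

/-- The spectrum of a finite graph: the multiset of eigenvalues of its (real symmetric) adjacency
matrix, listed with multiplicity. -/
def graphSpectrum : Multiset ℝ := (G.adjMatrix ℝ).charpoly.roots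

/-- The absolute values of the eigenvalues, with multiplicity, in decreasing order. -/
def eigenvalueMagnitudes : List ℝ := ((graphSpectrum G).map fun l => |l|).sort (· ≥ ·)

/-- The spectral gap of a graph: the largest eigenvalue (it is the eigenvalue of largest
magnitude) minus the second largest magnitude of an eigenvalue, eigenvalues being counted with
multiplicity. -/
def spectralGap : ℝ := (eigenvalueMagnitudes G).getD 0 0 - (eigenvalueMagnitudes G).getD 1 0

/-- The transition matrix of the uniform random walk on `G`: from `i`, each neighbour of `i` is
chosen with probability `1 / deg i`. -/
def walkMatrix : Matrix V V ℝ := fun i j => if G.Adj i j then (G.degree i : ℝ)⁻¹ else 0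

/-- The probability that the uniform random walk started at `i` is at `j` after `t` steps. -/
def walkProb (t : ℕ) (i j : V) : ℝ := (walkMatrix G ^ t) i j

end Graph

end

/-! ### The coordinate ring of the curve `ω² = h ω - β`, filtered by pole order at infinity -/

section CurveRing

open Polynomial

variable {K : Type*} [Field K] {β : K} {h : K[X]}

/-! The hyperbola graph is the Cayley graph of `R²` with connection set `H = -H`, so the characters
`ψ` of `R²` form an eigenbasis with eigenvalues `|R|² Ĥ(ψ)` (`charpoly_adjMatrix_cayley`). Hence
`C_R √|R*|` is the largest modulus of an eigenvalue at a nontrivial character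
(`kloostermanSalem_spec`). The spectral gap, the mixing rate and Hoffman's ratio bound follow from
this. The chromatic bound follows from the independence bound. An eigenvalue `±|H|` at a nontrivial
`ψ` means that `ψ` is constant, equal to `1` or `-1`, on `H`; this detects disconnectedness or
bipartiteness (`connected_and_not_bipartite_iff`).

For a field, the nontrivial eigenvalues are Kloosterman sums or degenerate sums of modulus 1, and
Weil's bound `2 √q` is proved by elementary means. The Stepanov–Bombieri method bounds the number of
points of `x + β / x = y ^ p - y + γ` over a field of `q²` elements, `q = p ^ m`, by `q² + O(p q)`
(`card_artinSchreier_curve_le`). Averaging over `γ` gives `O(p q)` for Kloosterman sums over that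
field. The identity `Kl_K + Kl_F² = 2 |F|` for a quadratic extension `K / F`
(`kloostermanSum_quadratic`) then removes the constant: a sum exceeding Weil's bound would have a
normalised excess growing without limit along a tower of quadratic extensions, against the `O(p q)`
bound. -/

/-- The ring homomorphism out of `K[X][ω]`, `ω² = h ω - β`, sending `X ↦ η` and `ω ↦ ξ`. -/
noncomputable def curveEval {B : Type*} [CommRing B] [Algebra K B] (β : K) (h : K[X]) (ξ η : B)
    (hξ : ξ * ξ = aeval η h * ξ - algebraMap K B β) : QuadraticAlgebra K[X] (C (-β)) h →+* B where
  toFun z := aeval η z.re + aeval η z.im * ξ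
  map_one' := by simp [QuadraticAlgebra.re_one, QuadraticAlgebra.im_one]
  map_zero' := by simp
  map_add' z w := by simp; ring
  map_mul' z w := by
    simp only [QuadraticAlgebra.re_mul, QuadraticAlgebra.im_mul, map_add, map_mul, aeval_C, map_neg]
    linear_combination (-(aeval η z.im * aeval η w.im)) * hξ

theorem curveEval_apply {B : Type*} [CommRing B] [Algebra K B] {ξ η : B}
    (hξ : ξ * ξ = aeval η h * ξ - algebraMap K B β) (z : QuadraticAlgebra K[X] (C (-β)) h) :
    curveEval β h ξ η hξ z = aeval η z.re + aeval η z.im * ξ := rfl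

theorem aeval_norm_eq_zero {B : Type*} [CommRing B] [Algebra K B] {ξ η : B}
    (hξ : ξ * ξ = aeval η h * ξ - algebraMap K B β) {z : QuadraticAlgebra K[X] (C (-β)) h}
    (hz : curveEval β h ξ η hξ z = 0) : aeval η z.norm = 0 := by
  rw [curveEval_apply] at hz
  simp only [QuadraticAlgebra.norm_def, map_sub, map_add, map_mul, aeval_C, map_neg]
  linear_combination (aeval η z.re + aeval η z.im * (aeval η h - ξ)) * hz
    + (aeval η z.im) ^ 2 * hξ

/-- Coprimality and `s ∣ r²` make `s` a unit. Then `r (r + h s) = -β s²` is a unit, so `r`, `r + h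
s` and finally `h` are constant. -/
theorem natDegree_eq_zero_of_isCoprime_quadratic (hβ : β ≠ 0) {r s : K[X]} (hco : IsCoprime r s)
    (key : r * r + h * r * s + C β * s * s = 0) : h.natDegree = 0 := by
  have hd : s ∣ r * r := ⟨-(h * r + C β * s), by linear_combination key⟩
  have hsu : IsUnit s := (hco.symm.mul_right hco.symm).isUnit_of_dvd' (dvd_refl s) hd
  have hru : IsUnit (r * (r + h * s)) := by
    have : r * (r + h * s) = -(C β * s * s) := by linear_combination key
    rw [this]
    exact (((isUnit_C.2 hβ.isUnit).mul hsu).mul hsu).neg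
  have h1 := natDegree_eq_zero_of_isUnit (isUnit_of_mul_isUnit_left hru)
  have h2 := natDegree_eq_zero_of_isUnit (isUnit_of_mul_isUnit_right hru)
  have h3 : h * s = (r + h * s) - r := by ring
  have h4 : (h * s).natDegree = 0 := by
    rw [h3]
    have := natDegree_sub_le (r + h * s) r
    omega
  by_cases hh : h = 0
  · rw [hh, natDegree_zero]
  · rw [natDegree_mul hh hsu.ne_zero] at h4
    omega

/-- Dividing by the gcd reduces to the coprime case. The norm form is thus anisotropic, which lets
zeros of a function be counted by its norm. -/
theorem eq_zero_of_quadratic_eq_zero (hβ : β ≠ 0) (hh : 0 < h.natDegree) {r s : K[X]}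
    (key : r * r + h * r * s + C β * s * s = 0) : s = 0 := by
  classical
  by_contra him
  have hg0 : EuclideanDomain.gcd r s ≠ 0 := fun h0 => him (EuclideanDomain.gcd_eq_zero_iff.1 h0).2
  obtain ⟨r', hr⟩ := EuclideanDomain.gcd_dvd_left r s
  obtain ⟨s', hs⟩ := EuclideanDomain.gcd_dvd_right r s
  have hco : IsCoprime r' s' := by
    have := EuclideanDomain.gcd_eq_gcd_ab r s
    refine ⟨EuclideanDomain.gcdA r s, EuclideanDomain.gcdB r s, mul_left_cancel₀ hg0 ?_⟩
    linear_combination (-EuclideanDomain.gcdA r s) * hr - EuclideanDomain.gcdB r s * hs - this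
  generalize EuclideanDomain.gcd r s = g at *
  subst hr hs
  have : g * g * (r' * r' + h * r' * s' + C β * s' * s') = 0 := by
    linear_combination key
  have := natDegree_eq_zero_of_isCoprime_quadratic (h := h) hβ hco (by simpa [hg0] using this)
  omega

theorem curve_norm_ne_zero (hβ : β ≠ 0) (hh : 0 < h.natDegree)
    {z : QuadraticAlgebra K[X] (C (-β)) h} (hz : z ≠ 0) : z.norm ≠ 0 := by
  intro hN
  rw [QuadraticAlgebra.norm_def] at hN
  have h0 : z.im = 0 := eq_zero_of_quadratic_eq_zero (r := z.re) hβ hh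
    (by linear_combination hN + z.im * z.im * (C_neg (a := β)))
  rw [h0] at hN
  have : z.re = 0 := by simpa using hN
  exact hz (QuadraticAlgebra.ext this h0)

/-- The functions on the curve `ω² = h ω - β` with poles of order at most `k` at each of the two
points at infinity, where `p` is the degree of `h`. -/
def curveFilt (β : K) (h : K[X]) (p k : ℕ) : Submodule K (QuadraticAlgebra K[X] (C (-β)) h) where
  -- `degree`, with value `⊥` at `0`, makes the second condition vacuous when `z.im = 0`. The shift
  -- by `p` is the pole order of `ω` at one of the points at infinity.
  carrier := {z | z.re.degree ≤ k ∧ z.im.degree + p ≤ k}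
  zero_mem' := by simp
  add_mem' {z w} hz hw := by
    refine ⟨(degree_add_le _ _).trans (max_le hz.1 hw.1), ?_⟩
    refine (add_le_add_left (degree_add_le z.im w.im) (p : WithBot ℕ)).trans ?_
    rcases max_choice z.im.degree w.im.degree with h | h <;> rw [h]
    exacts [hz.2, hw.2]
  smul_mem' c z hz := by
    refine ⟨(degree_smul_le _ _).trans hz.1, ?_⟩
    exact (add_le_add_left (degree_smul_le c z.im) (p : WithBot ℕ)).trans hz.2

theorem mem_curveFilt {p k : ℕ} {z : QuadraticAlgebra K[X] (C (-β)) h} :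
    z ∈ curveFilt β h p k ↔ z.re.degree ≤ k ∧ z.im.degree + p ≤ k := Iff.rfl

theorem curveFilt_mul_mem {p k l : ℕ} (hp : h.degree ≤ p)
    {z w : QuadraticAlgebra K[X] (C (-β)) h}
    (hz : z ∈ curveFilt β h p k) (hw : w ∈ curveFilt β h p l) :
    z * w ∈ curveFilt β h p (k + l) := by
  have e : ∀ z : QuadraticAlgebra K[X] (C (-β)) h, z.im.degree ≤ z.im.degree + p := fun z =>
    le_add_of_nonneg_right (by exact_mod_cast Nat.zero_le p)
  rw [mem_curveFilt] at *
  obtain ⟨h1, h2⟩ := hz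
  obtain ⟨h3, h4⟩ := hw
  rw [QuadraticAlgebra.re_mul, QuadraticAlgebra.im_mul]
  constructor
  · refine (degree_add_le _ _).trans (max_le ?_ ?_)
    · rw [degree_mul]; push_cast; exact add_le_add h1 h3
    · rw [degree_mul, degree_mul]; push_cast
      calc (C (-β)).degree + z.im.degree + w.im.degree
          ≤ 0 + (z.im.degree + p) + (w.im.degree + p) :=
            add_le_add (add_le_add degree_C_le (e z)) (e w)
        _ ≤ k + l := by rw [zero_add]; exact add_le_add h2 h4
  · rw [← max_self ((k + l : ℕ) : WithBot ℕ)]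
    refine (add_le_add_left (degree_add_le _ _) _).trans ?_
    have aux1 : (z.re * w.im + z.im * w.re).degree + p ≤ ((k + l : ℕ) : WithBot ℕ) := by
      refine (add_le_add_left (degree_add_le _ _) _).trans ?_
      rcases max_choice (z.re * w.im).degree (z.im * w.re).degree with h | h <;> rw [h]
      · rw [degree_mul, add_assoc]; push_cast; exact add_le_add h1 h4
      · rw [degree_mul, add_right_comm]; push_cast; exact add_le_add h2 h3
    have aux2 : (h * z.im * w.im).degree + p ≤ ((k + l : ℕ) : WithBot ℕ) := by
      rw [degree_mul, degree_mul]; push_cast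
      calc h.degree + z.im.degree + w.im.degree + p
          ≤ p + z.im.degree + w.im.degree + p := by gcongr
        _ = (z.im.degree + p) + (w.im.degree + p) := by abel
        _ ≤ k + l := add_le_add h2 h4
    rw [max_self]
    rcases max_choice (z.re * w.im + z.im * w.re).degree (h * z.im * w.im).degree with h | h <;>
      rw [h]
    exacts [aux1, aux2]

theorem curveFilt_pow_mem {p k : ℕ} (hp : h.degree ≤ p)
    {z : QuadraticAlgebra K[X] (C (-β)) h}
    (hz : z ∈ curveFilt β h p k) (n : ℕ) : z ^ n ∈ curveFilt β h p (n * k) := by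
  induction n with
  | zero =>
    rw [mem_curveFilt]
    simp [QuadraticAlgebra.re_one, QuadraticAlgebra.im_one]
  | succ n ih =>
    rw [pow_succ, add_mul, one_mul]
    exact curveFilt_mul_mem hp ih hz

theorem natDegree_norm_le {p k : ℕ} (hp : h.degree ≤ p)
    {z : QuadraticAlgebra K[X] (C (-β)) h} (hz : z ∈ curveFilt β h p k) :
    z.norm.natDegree ≤ 2 * k := by
  have e : z.im.degree ≤ z.im.degree + p :=
    le_add_of_nonneg_right (by exact_mod_cast Nat.zero_le p)
  rw [mem_curveFilt] at hz
  obtain ⟨h1, h2⟩ := hz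
  rw [natDegree_le_iff_degree_le, QuadraticAlgebra.norm_def, two_mul]
  push_cast
  refine (degree_sub_le _ _).trans (max_le ((degree_add_le _ _).trans (max_le ?_ ?_)) ?_)
  · rw [degree_mul]; exact add_le_add h1 h1
  · rw [degree_mul, degree_mul]
    calc h.degree + z.re.degree + z.im.degree ≤ p + k + z.im.degree := by gcongr
      _ = k + (z.im.degree + p) := by abel
      _ ≤ k + k := add_le_add le_rfl h2
  · rw [degree_mul, degree_mul]
    calc (C (-β)).degree + z.im.degree + z.im.degree
          ≤ 0 + (z.im.degree + p) + (z.im.degree + p) :=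
            add_le_add (add_le_add degree_C_le e) e
        _ ≤ k + k := by rw [zero_add]; exact add_le_add h2 h2

/-- The coordinates of an element of `curveFilt`. -/
noncomputable def curveFiltEquiv (β : K) (h : K[X]) {p k : ℕ} (hpk : p ≤ k) :
    curveFilt β h p k ≃ₗ[K] degreeLT K (k + 1) × degreeLT K (k + 1 - p) where
  toFun z := (⟨z.1.re, by
      rw [mem_degreeLT]; exact z.2.1.trans_lt (by exact_mod_cast Nat.lt_succ_self k)⟩,
    ⟨z.1.im, by
      rw [mem_degreeLT]
      have := z.2.2
      by_cases h0 : z.1.im = 0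
      · rw [h0, degree_zero]; exact WithBot.bot_lt_coe _
      · rw [degree_eq_natDegree h0] at this ⊢
        norm_cast at this ⊢
        omega⟩)
  invFun x := ⟨⟨x.1.1, x.2.1⟩, by
    obtain ⟨⟨x, hx⟩, ⟨y, hy⟩⟩ := x
    rw [mem_degreeLT] at hx hy
    rw [mem_curveFilt]
    constructor
    · by_cases h0 : x = 0
      · simp [h0]
      · simp only
        rw [degree_eq_natDegree h0] at hx ⊢
        norm_cast at hx ⊢
        omega
    · by_cases h0 : y = 0
      · simp [h0]
      · simp only
        rw [degree_eq_natDegree h0] at hy ⊢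
        norm_cast at hy ⊢
        omega⟩
  left_inv z := rfl
  right_inv x := rfl
  map_add' z w := rfl
  map_smul' c z := rfl

instance {p k : ℕ} [hpk : Fact (p ≤ k)] : FiniteDimensional K (curveFilt β h p k) :=
  (curveFiltEquiv β h hpk.out).symm.finiteDimensional

/-- The coordinates have degrees at most `k` and `k - p`. The value is the one Riemann–Roch predicts
for degree `2 k` and genus `p - 1`. -/
theorem finrank_curveFilt {p k : ℕ} (hpk : p ≤ k) :
    Module.finrank K (curveFilt β h p k) = 2 * k + 2 - p := by
  rw [(curveFiltEquiv β h hpk).finrank_eq, Module.finrank_prod,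
    (degreeLTEquiv K _).finrank_eq, (degreeLTEquiv K _).finrank_eq]
  simp
  omega

end CurveRing

/-! ### Zeros of functions on the curve, and independence over `p ^ m`-th powers -/

section CurveRing

open Polynomial

variable {K : Type*} [Field K] {β : K} {h : K[X]}

/-- Two points over `η` can both be zeros only if `z.re` and `z.im` vanish at `η`, and then `(X -
η)²` divides the norm. Otherwise there is at most one zero, and the norm vanishes there. -/
theorem card_curve_fiber_le [Fintype K] [DecidableEq K]
    {z : QuadraticAlgebra K[X] (C (-β)) h} (hN : z.norm ≠ 0) (η : K) :
    (Finset.univ.filter fun P : K × K => (P.1 * P.1 = h.eval P.2 * P.1 - β ∧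
      z.re.eval P.2 + z.im.eval P.2 * P.1 = 0) ∧ P.2 = η).card ≤ z.norm.rootMultiplicity η := by
  rcases Finset.eq_empty_or_nonempty (Finset.univ.filter fun P : K × K =>
      (P.1 * P.1 = h.eval P.2 * P.1 - β ∧
      z.re.eval P.2 + z.im.eval P.2 * P.1 = 0) ∧ P.2 = η) with h0 | ⟨⟨ξ, y⟩, hP⟩
  · rw [h0]; simp
  simp only [Finset.mem_filter, Finset.mem_univ, true_and] at hP
  obtain ⟨⟨hc, hz⟩, rfl⟩ := hP
  by_cases him : z.im.eval y = 0
  · have hre : z.re.eval y = 0 := by simpa [him] using hz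
    have hsub : (Finset.univ.filter fun P : K × K => (P.1 * P.1 = h.eval P.2 * P.1 - β ∧
      z.re.eval P.2 + z.im.eval P.2 * P.1 = 0) ∧ P.2 = y) ⊆ {(ξ, y), (h.eval y - ξ, y)} := by
      rintro ⟨x, y'⟩ hx
      simp only [Finset.mem_filter, Finset.mem_univ, true_and] at hx
      obtain ⟨⟨hx, -⟩, rfl⟩ := hx
      have : (x - ξ) * (x - (h.eval y' - ξ)) = 0 := by linear_combination hx - hc
      rcases mul_eq_zero.1 this with h1 | h1
      · simp [sub_eq_zero.1 h1]
      · simp [sub_eq_zero.1 h1]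
    refine (Finset.card_le_card hsub).trans (Finset.card_le_two.trans ?_)
    rw [le_rootMultiplicity_iff hN, QuadraticAlgebra.norm_def]
    obtain ⟨r, hr⟩ := dvd_iff_isRoot.2 hre
    obtain ⟨s, hs⟩ := dvd_iff_isRoot.2 him
    rw [hr, hs]
    exact ⟨r * r + h * r * s - C (-β) * s * s, by ring⟩
  · have hsub : (Finset.univ.filter fun P : K × K => (P.1 * P.1 = h.eval P.2 * P.1 - β ∧
      z.re.eval P.2 + z.im.eval P.2 * P.1 = 0) ∧ P.2 = y) ⊆ {(ξ, y)} := by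
      rintro ⟨x, y'⟩ hx
      simp only [Finset.mem_filter, Finset.mem_univ, true_and] at hx
      obtain ⟨⟨-, hx⟩, rfl⟩ := hx
      have : x = ξ := mul_left_cancel₀ him (by linear_combination hx - hz)
      simp [this]
    refine (Finset.card_le_card hsub).trans ?_
    rw [Finset.card_singleton, Nat.succ_le_iff, rootMultiplicity_pos hN, IsRoot.def]
    have := aeval_norm_eq_zero (β := β) (h := h) (ξ := ξ) (η := y) (B := K) (z := z)
      (by simpa [coe_aeval_eq_eval] using hc)
      (by rw [curveEval_apply]; simpa [coe_aeval_eq_eval] using hz)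
    simpa [coe_aeval_eq_eval] using this

/-- A nonzero function with poles of order at most `k` at the two points at infinity has at most
`2 k` rational zeros. -/
theorem card_curve_zeros_le [Fintype K] [DecidableEq K] (hβ : β ≠ 0) (hh : 0 < h.natDegree)
    {p k : ℕ} (hp : h.degree ≤ p) {z : QuadraticAlgebra K[X] (C (-β)) h} (hz : z ≠ 0)
    (hzk : z ∈ curveFilt β h p k) :
    (Finset.univ.filter fun P : K × K => P.1 * P.1 = h.eval P.2 * P.1 - β ∧
      z.re.eval P.2 + z.im.eval P.2 * P.1 = 0).card ≤ 2 * k := by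
  have hN := curve_norm_ne_zero hβ hh hz
  refine le_trans ?_ (natDegree_norm_le hp hzk)
  refine le_trans ?_ (card_roots' z.norm)
  rw [Finset.card_eq_sum_card_fiberwise (f := Prod.snd) (t := Finset.univ) (fun _ _ => by simp),
    ← Multiset.sum_count_eq_card (s := Finset.univ) (fun _ _ => by simp)]
  refine Finset.sum_le_sum fun η _ => ?_
  rw [count_roots, Finset.filter_filter]
  exact card_curve_fiber_le hN η

theorem isUnit_add_of_pow_eq_zero {B : Type*} [CommRing B] {u v : B} {n : ℕ} (hu : IsUnit u)
    (hv : v ^ n = 0) : IsUnit (u + v) :=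
  IsNilpotent.isUnit_add_left_of_commute ⟨n, hv⟩ hu (Commute.all _ _)

/-- A formal parametrisation, to order `p ^ m`, of the curve `x + β / x = y ^ p - y + γ` near an
unramified point. -/
theorem exists_local_param {p : ℕ} [Fact p.Prime] {B : Type*} [CommRing B] [Algebra K B] [CharP B p] {m : ℕ} (hm : 0 < m)
    {τ : B} (hτ : τ ^ p ^ m = 0) {γ x₀ y₀ : K} (hx₀ : x₀ ≠ 0) (hx₀β : x₀ * x₀ ≠ β)
    (hP : x₀ * x₀ = (y₀ ^ p - y₀ + γ) * x₀ - β) :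
    ∃ ξ η : B, ξ * ξ = aeval η (X ^ p - X + C γ : K[X]) * ξ - algebraMap K B β ∧
      ξ = algebraMap K B x₀ + τ ∧ ∃ e, IsUnit e ∧ η = algebraMap K B y₀ + τ * e := by
  have hnil : ∀ c, (τ * c) ^ p ^ m = 0 := fun c => by rw [mul_pow, hτ, zero_mul]
  set X₀ := algebraMap K B x₀ with hX₀
  set b := algebraMap K B β with hb
  set ix := algebraMap K B x₀⁻¹ with hix
  have hxi : X₀ * ix = 1 := by rw [hX₀, hix, ← map_mul, mul_inv_cancel₀ hx₀, map_one]
  have hξu : IsUnit (X₀ + τ) :=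
    isUnit_add_of_pow_eq_zero ((IsUnit.mk0 _ hx₀).map _) hτ
  obtain ⟨u, hu⟩ := hξu.exists_right_inv
  -- `τ * v` is the increment of `x + β / x` between `x₀` and `x₀ + τ`. It is `τ` times a unit
  -- exactly because `x₀² ≠ β`.
  set v := ix * u * (X₀ * (X₀ + τ) - b) with hv
  have hvu : IsUnit v := by
    refine ((IsUnit.of_mul_eq_one _ (by rw [mul_comm]; exact hxi)).mul
      (IsUnit.of_mul_eq_one _ (by rw [mul_comm]; exact hu))).mul ?_
    have : X₀ * (X₀ + τ) - b = algebraMap K B (x₀ * x₀ - β) + τ * X₀ := by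
      rw [map_sub, map_mul]; ring
    rw [this]
    exact isUnit_add_of_pow_eq_zero ((IsUnit.mk0 _ (sub_ne_zero.2 hx₀β)).map _) (hnil _)
  set w := τ * v with hw
  have hwnil : w ^ p ^ m = 0 := hnil v
  have hp1 : 1 < p := (Fact.out : p.Prime).one_lt
  -- The Artin–Schreier equation `u ^ p - u = w` has the telescoping solution `u = -∑ w ^ p ^ k`,
  -- the remainder `w ^ p ^ m` being zero.
  refine ⟨X₀ + τ, algebraMap K B y₀ - ∑ k ∈ Finset.range m, w ^ p ^ k, ?_, rfl, ?_⟩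
  · have hη : aeval (algebraMap K B y₀ - ∑ k ∈ Finset.range m, w ^ p ^ k)
        (X ^ p - X + C γ : K[X]) = algebraMap K B (y₀ ^ p - y₀ + γ) + w := by
      have htel := Finset.sum_range_sub' (fun k => w ^ p ^ k) m
      rw [Finset.sum_sub_distrib] at htel
      simp only [map_add, map_sub, map_pow, aeval_X, aeval_C]
      rw [sub_pow_char, sum_pow_char]
      have : ∀ k, (w ^ p ^ k) ^ p = w ^ p ^ (k + 1) := fun k => by rw [← pow_mul, ← pow_succ]
      simp only [this]
      rw [hwnil, pow_zero, pow_one, sub_zero] at htel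
      linear_combination htel
    have hP' : algebraMap K B (y₀ ^ p - y₀ + γ) = X₀ + b * ix := by
      have : y₀ ^ p - y₀ + γ = x₀ + β * x₀⁻¹ := by
        field_simp; linear_combination -hP
      rw [this, map_add, map_mul]
    rw [hη, hP', hw, hv]
    have e1 : b * ix * (X₀ + τ) + τ * (ix * u * (X₀ * (X₀ + τ) - b)) * (X₀ + τ)
        = τ * (X₀ + τ) + b := by
      linear_combination (b + τ * X₀ + τ * τ) * hxi +
        (τ * ix * X₀ * (X₀ + τ) - τ * ix * b) * hu
    linear_combination -e1
  -- The term `k = 0` is `w = τ * v`; all others are divisible by `w²`, so the sum is `τ` times a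
  -- unit.
  · obtain ⟨m, rfl⟩ : ∃ m', m = m' + 1 := ⟨m - 1, by omega⟩
    refine ⟨-(v * (1 + τ * (v * ∑ k ∈ Finset.range m, w ^ (p ^ (k + 1) - 2)))), ?_, ?_⟩
    · exact (hvu.mul (isUnit_add_of_pow_eq_zero isUnit_one (hnil _))).neg
    · have e2 : ∀ k, w ^ p ^ (k + 1) = w * (w * w ^ (p ^ (k + 1) - 2)) := fun k => by
        have : 2 ≤ p ^ (k + 1) := hp1.trans_le (Nat.le_self_pow (by omega) p)
        rw [← pow_succ', ← pow_succ']
        congr 1; omega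
      rw [Finset.sum_range_succ']
      simp only [e2]
      rw [← Finset.mul_sum, ← Finset.mul_sum, pow_zero, pow_one]
      generalize ∑ k ∈ Finset.range m, w ^ (p ^ (k + 1) - 2) = s
      rw [hw]; ring

theorem curveEval_sub_dvd {p : ℕ} {B : Type*} [CommRing B] [Algebra K B] {γ x₀ y₀ : K} {ξ η τ e : B}
    (hξ : ξ * ξ = aeval η (X ^ p - X + C γ : K[X]) * ξ - algebraMap K B β)
    (hx : ξ = algebraMap K B x₀ + τ) (hy : η = algebraMap K B y₀ + τ * e)
    (z : QuadraticAlgebra K[X] (C (-β)) (X ^ p - X + C γ : K[X])) :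
    τ ∣ curveEval β _ ξ η hξ z - algebraMap K B (z.re.eval y₀ + z.im.eval y₀ * x₀) := by
  have aux : ∀ f : K[X], τ ∣ aeval η f - algebraMap K B (f.eval y₀) := fun f => by
    have h1 : algebraMap K B (f.eval y₀) = (f.map (algebraMap K B)).eval (algebraMap K B y₀) := by
      rw [eval_map_algebraMap, aeval_algebraMap_apply_eq_algebraMap_eval]
    have h2 : aeval η f = (f.map (algebraMap K B)).eval η := by rw [eval_map_algebraMap]
    rw [h1, h2]
    exact Dvd.dvd.trans ⟨e, by rw [hy]; ring⟩ (sub_dvd_eval_sub η (algebraMap K B y₀) _)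
  obtain ⟨r, hr⟩ := aux z.re
  obtain ⟨s, hs⟩ := aux z.im
  rw [curveEval_apply, map_add, map_mul]
  refine ⟨r + s * ξ + algebraMap K B (z.im.eval y₀), ?_⟩
  linear_combination hr + ξ * hs + algebraMap K B (z.im.eval y₀) * hx

theorem degree_artinSchreier (p : ℕ) [Fact p.Prime] (γ : K) :
    (X ^ p - X + C γ : K[X]).degree = p := by
  have hp1 : 1 < p := (Fact.out : p.Prime).one_lt
  rw [sub_add]
  have : (X - C γ : K[X]).degree < (X ^ p : K[X]).degree := by
    rw [degree_X_sub_C, degree_X_pow]; exact_mod_cast hp1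
  rw [degree_sub_eq_left_of_degree_lt this, degree_X_pow]

theorem natDegree_artinSchreier (p : ℕ) [Fact p.Prime] (γ : K) :
    (X ^ p - X + C γ : K[X]).natDegree = p :=
  natDegree_eq_of_degree_eq_some (degree_artinSchreier p γ)

/-- Functions with few poles are linearly independent over the `p ^ m`-th powers. -/
theorem sum_mul_pow_ne_zero {p : ℕ} [Fact p.Prime] [CharP K p] {m : ℕ} (hm : 0 < m) (hβ : β ≠ 0) {γ : K} {a : ℕ}
    (ha : 2 * a < p ^ m) {ι : Type*} [Fintype ι]
    (σ : Module.Basis ι K (curveFilt β (X ^ p - X + C γ : K[X]) p a))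
    (t : ι → QuadraticAlgebra K[X] (C (-β)) (X ^ p - X + C γ : K[X])) {x₀ y₀ : K}
    (hx₀β : x₀ * x₀ ≠ β) (hP : x₀ * x₀ = (y₀ ^ p - y₀ + γ) * x₀ - β) {i : ι}
    (hi : (t i).re.eval y₀ + (t i).im.eval y₀ * x₀ ≠ 0) :
    ∑ k, (σ k : QuadraticAlgebra K[X] (C (-β)) (X ^ p - X + C γ : K[X])) * t k ^ p ^ m ≠ 0 := by
  classical
  intro h0
  have hp0 : 0 < p := (Fact.out : p.Prime).pos
  have hx₀ : x₀ ≠ 0 := by rintro rfl; exact hβ (by linear_combination hP)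
  -- Modulo `τ ^ p ^ m`, the `p ^ m`-th power of a function along the formal branch is the constant
  -- given by its value at the base point.
  let B := AdjoinRoot (X ^ p ^ m : K[X])
  let τ : B := AdjoinRoot.root _
  have hτ : τ ^ p ^ m = 0 := by
    have := AdjoinRoot.eval₂_root (X ^ p ^ m : K[X])
    simpa using this
  have hτ' : ∀ j, τ ^ j = 0 → p ^ m ≤ j := fun j hj => by
    have : AdjoinRoot.mk (X ^ p ^ m : K[X]) (X ^ j) = 0 := by
      rw [map_pow, AdjoinRoot.mk_X]; exact hj
    rw [AdjoinRoot.mk_eq_zero] at this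
    exact (pow_dvd_pow_iff X_ne_zero not_isUnit_X).1 this
  have hnt : Nontrivial B := AdjoinRoot.nontrivial _ (by
    rw [degree_X_pow]; exact_mod_cast (pow_pos hp0 m).ne')
  have hchar : CharP B p := charP_of_injective_algebraMap (algebraMap K B).injective p
  obtain ⟨ξ, η, hξ, hx, e, he, hy⟩ := exists_local_param (B := B) hm hτ hx₀ hx₀β hP
  set θ := curveEval β _ ξ η hξ with hθ
  let c : ι → K := fun k => ((t k).re.eval y₀ + (t k).im.eval y₀ * x₀) ^ p ^ m
  have hθt : ∀ k, θ (t k ^ p ^ m) = algebraMap K B (c k) := fun k => by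
    obtain ⟨d, hd⟩ := curveEval_sub_dvd hξ hx hy (t k)
    rw [map_pow, hθ, sub_eq_iff_eq_add.1 hd, add_pow_char_pow, mul_pow, hτ, zero_mul, zero_add,
      ← map_pow]
  have hθC : ∀ k : K, ∀ z, θ (k • z) = algebraMap K B k * θ z := fun k z => by
    rw [hθ, curveEval_apply, curveEval_apply]
    rw [QuadraticAlgebra.re_smul, QuadraticAlgebra.im_smul, map_smul, map_smul, Algebra.smul_def,
      Algebra.smul_def]
    ring
  -- The supposed relation freezes into a constant combination of the `σ k`, nonzero by
  -- independence, yet vanishing to order `p ^ m` along the branch. Its norm has degree at most `2 a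
  -- < p ^ m`, a contradiction.
  let s : curveFilt β (X ^ p - X + C γ : K[X]) p a := ∑ k, c k • σ k
  have hs0 : s ≠ 0 := fun hs => by
    have := Fintype.linearIndependent_iff.1 σ.linearIndependent c hs i
    exact hi (pow_eq_zero_iff (pow_pos hp0 m).ne' |>.1 this)
  have hs0' : s.1 ≠ 0 := fun h => hs0 (Subtype.ext h)
  have hθs : θ s.1 = 0 := by
    have : s.1 = ∑ k, c k • (σ k).1 := by
      simp only [s, AddSubmonoidClass.coe_finsetSum, SetLike.val_smul]
    rw [this, map_sum, ← map_zero θ, ← h0, map_sum]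
    refine Finset.sum_congr rfl fun k _ => ?_
    rw [hθC, map_mul, hθt, mul_comm]
  have hN0 := curve_norm_ne_zero hβ (by rw [natDegree_artinSchreier]; exact hp0) hs0'
  have hN := aeval_norm_eq_zero hξ hθs
  have hdeg := natDegree_norm_le (degree_artinSchreier p γ).le s.2
  obtain ⟨g, hg, hgd⟩ := exists_eq_pow_rootMultiplicity_mul_and_not_dvd _ hN0 y₀
  have hj : rootMultiplicity y₀ s.1.norm ≤ 2 * a := by
    refine le_trans ?_ hdeg
    rw [← count_roots]
    exact (Multiset.count_le_card _ _).trans (card_roots' _)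
  generalize rootMultiplicity y₀ s.1.norm = j at hg hj
  rw [hg, map_mul, map_pow, map_sub, aeval_X, aeval_C] at hN
  have hgu : IsUnit (aeval η g) := by
    have hz := curveEval_sub_dvd hξ hx hy ⟨g, 0⟩
    rw [curveEval_apply] at hz
    simp only [map_zero, zero_mul, add_zero, eval_zero] at hz
    obtain ⟨d, hd⟩ := hz
    rw [sub_eq_iff_eq_add, add_comm] at hd
    rw [hd]
    refine isUnit_add_of_pow_eq_zero (n := p ^ m) ((IsUnit.mk0 _ ?_).map _) ?_
    · exact fun h => hgd (dvd_iff_isRoot.2 h)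
    · rw [mul_pow, hτ, zero_mul]
  have : τ ^ j = 0 := by
    have h1 : η - algebraMap K B y₀ = τ * e := by rw [hy]; ring
    rw [h1, mul_pow, mul_assoc] at hN
    exact (((he.pow j).mul hgu).mul_left_eq_zero).1 hN
  have := hτ' j this
  omega

end CurveRing

/-! ### Stepanov's auxiliary function and the point count -/

section CurveRing

open Polynomial

variable {K : Type*} [Field K]

/-- With `A = 2 a` and `b = a + p + 2` the right side is `(A + 2 - p) (A + p + 6)`. The terms linear
in `p` nearly cancel, leaving a surplus linear in `q` that dominates `p²`. -/
theorem frobenius_power_dimension_lt {p q a : ℕ} (hpq : (p + 4) ^ 2 ≤ q) (ha₁ : 2 * a < q)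
    (ha₂ : q ≤ 2 * a + 2) :
    2 * (q * a + (a + p + 2)) + 2 - p < (2 * a + 2 - p) * (2 * (a + p + 2) + 2 - p) := by
  have h1 : p ≤ 2 * a + 2 := by nlinarith
  zify [h1, (by omega : p ≤ 2 * (a + p + 2) + 2), (by nlinarith : p ≤ 2 * (q * a + (a + p + 2)) + 2)]
  zify at hpq ha₁ ha₂
  have hq : ((p : ℤ) + 4) ^ 2 ≤ q := hpq
  have hp : (0 : ℤ) ≤ p := Int.natCast_nonneg p
  generalize hA : (2 * a : ℤ) = A at *
  have e1 : (2 * ((q : ℤ) * a + (a + p + 2)) + 2 - p) = q * A + A + p + 6 := by rw [← hA]; ring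
  have e2 : ((A + 2 - p) * (2 * ((a : ℤ) + p + 2) + 2 - p)) = (A + 2 - p) * (A + p + 6) := by
    rw [← hA]; ring
  rw [e1, e2]
  rcases (by omega : A = q - 1 ∨ A = q - 2) with h | h <;> rw [h] <;> nlinarith

theorem card_artinSchreier_curve_le [Fintype K] [DecidableEq K] {p m : ℕ} [Fact p.Prime]
    [CharP K p] (hm : 0 < m) (hK : Fintype.card K = (p ^ m) ^ 2) (hpm : (p + 4) ^ 2 ≤ p ^ m)
    {β : K} (hβ : β ≠ 0) (γ : K) :
    (Finset.univ.filter fun P : K × K => P.1 * P.1 = (P.2 ^ p - P.2 + γ) * P.1 - β).card ≤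
      (p ^ m) ^ 2 + (2 * p + 5) * p ^ m := by
  have hp1 : 1 < p := (Fact.out : p.Prime).one_lt
  set q := p ^ m with hq
  set h : K[X] := X ^ p - X + C γ with hh
  have hdeg : h.degree ≤ p := (degree_artinSchreier p γ).le
  have hnat : 0 < h.natDegree := by rw [natDegree_artinSchreier]; omega
  have heval : ∀ y, h.eval y = y ^ p - y + γ := fun y => by simp [hh]
  set a := (q - 1) / 2 with ha
  have hq0 : 16 ≤ q := by nlinarith
  have hpa : p ≤ a := by
    have : 2 * p + 2 ≤ q := by nlinarith
    omega
  have ha₁ : 2 * a < q := by omega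
  have ha₂ : q ≤ 2 * a + 2 := by omega
  set b := a + p + 2 with hb
  have : Fact (p ≤ a) := ⟨hpa⟩
  have : Fact (p ≤ b) := ⟨by omega⟩
  have : Fact (p ≤ q * a + b) := ⟨by nlinarith⟩
  let σ := Module.finBasis K (curveFilt β h p a)
  -- A kernel element `t` is a relation `∑ σ k ^ q * t k = 0`, forced by the dimension count. The
  -- auxiliary function is `∑ σ k * t k ^ q`, whose pole order is at most `a + q b`, with `2 (a + q
  -- b)` close to `q²`.
  let L₀ : (Fin (Module.finrank K (curveFilt β h p a)) → curveFilt β h p b) →ₗ[K]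
      QuadraticAlgebra K[X] (C (-β)) h :=
    ∑ k, (LinearMap.mulLeft K ((σ k).1 ^ q)) ∘ₗ (curveFilt β h p b).subtype ∘ₗ LinearMap.proj k
  have hL₀ : ∀ t, L₀ t = ∑ k, (σ k).1 ^ q * (t k).1 := fun t => by
    simp [L₀, LinearMap.sum_apply]
  let L := L₀.codRestrict (curveFilt β h p (q * a + b)) (fun t => by
    rw [hL₀]
    exact Submodule.sum_mem _ fun k _ =>
      curveFilt_mul_mem hdeg (curveFilt_pow_mem hdeg (σ k).2 q) (t k).2)
  have hker : LinearMap.ker L ≠ ⊥ := by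
    refine LinearMap.ker_ne_bot_of_finrank_lt ?_
    rw [finrank_curveFilt (by nlinarith), Module.finrank_pi_fintype]
    simp only [Finset.sum_const, Finset.card_univ, Fintype.card_fin, smul_eq_mul]
    rw [finrank_curveFilt hpa, finrank_curveFilt (by omega)]
    exact frobenius_power_dimension_lt hpm ha₁ ha₂
  obtain ⟨t, htL, ht0⟩ := Submodule.exists_mem_ne_zero_of_ne_bot hker
  have ht : ∑ k, (σ k).1 ^ q * (t k).1 = 0 := by
    rw [← hL₀]
    exact congrArg Subtype.val (LinearMap.mem_ker.1 htL)
  obtain ⟨i₀, hi₀⟩ := Function.ne_iff.1 ht0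
  have hrel : ∀ P : K × K, P.1 * P.1 = (P.2 ^ p - P.2 + γ) * P.1 - β →
      P.1 * P.1 = aeval P.2 h * P.1 - algebraMap K K β := fun P hP => by
    rw [coe_aeval_eq_eval, heval]; exact hP
  have hev : ∀ (P : K × K) (hP : P.1 * P.1 = (P.2 ^ p - P.2 + γ) * P.1 - β)
      (z : QuadraticAlgebra K[X] (C (-β)) h), curveEval β h P.1 P.2 (hrel P hP) z =
        z.re.eval P.2 + z.im.eval P.2 * P.1 := fun P hP z => by
    rw [curveEval_apply, coe_aeval_eq_eval]
  by_cases hex : ∃ P : K × K, P.1 * P.1 = (P.2 ^ p - P.2 + γ) * P.1 - β ∧ P.1 * P.1 ≠ β ∧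
      ∃ i, (t i).1.re.eval P.2 + (t i).1.im.eval P.2 * P.1 ≠ 0
  · obtain ⟨P, hP, hPβ, i, hi⟩ := hex
    have hne := sum_mul_pow_ne_zero hm hβ ha₁ σ (fun k => (t k).1) hPβ hP hi
    have hmem : ∑ k, (σ k).1 * (t k).1 ^ q ∈ curveFilt β h p (a + q * b) :=
      Submodule.sum_mem _ fun k _ =>
        curveFilt_mul_mem hdeg (σ k).2 (curveFilt_pow_mem hdeg (t k).2 q)
    have hcard := card_curve_zeros_le hβ hnat hdeg hne hmem
    refine le_trans (Finset.card_le_card ?_) (hcard.trans ?_)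
    · intro P hP
      simp only [Finset.mem_filter, Finset.mem_univ, true_and] at hP ⊢
      refine ⟨by rw [heval]; exact hP, ?_⟩
      rw [← hev P hP]
      -- At a rational point `t k ^ (q * q) = t k`, so the `q`-th power of the auxiliary function
      -- equals the relation defining `t`.
      refine (pow_eq_zero_iff (n := q) (by omega)).1 ?_
      have hexp : ExpChar K p := ExpChar.prime Fact.out
      rw [map_sum, hq, sum_pow_char_pow, ← hq, ← map_zero (curveEval β h P.1 P.2 (hrel P hP)),
        ← ht, map_sum]
      refine Finset.sum_congr rfl fun k _ => ?_
      rw [map_mul, map_mul, map_pow, map_pow, mul_pow, ← pow_mul, ← pow_two, ← hK,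
        FiniteField.pow_card]
    · nlinarith
  -- If every `t k` vanishes at all rational points with `x² ≠ β`, then `t i₀` times `h ω - 2 β = ω²
  -- - β` vanishes at all rational points, and its pole order is only `b + 2 p`.
  · push Not at hex
    have hω : (⟨C (-(2 * β)), h⟩ : QuadraticAlgebra K[X] (C (-β)) h) ≠ 0 := fun h0 => by
      have : h = 0 := congrArg QuadraticAlgebra.im h0
      rw [this] at hnat; simp at hnat
    have hωmem : (⟨C (-(2 * β)), h⟩ : QuadraticAlgebra K[X] (C (-β)) h) ∈
        curveFilt β h p (p + p) := by
      rw [mem_curveFilt]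
      refine ⟨degree_C_le.trans (by exact_mod_cast Nat.zero_le _), ?_⟩
      push_cast
      exact add_le_add hdeg le_rfl
    have hmem := curveFilt_mul_mem hdeg (t i₀).2 hωmem
    have hne : (t i₀).1 * (⟨C (-(2 * β)), h⟩ : QuadraticAlgebra K[X] (C (-β)) h) ≠ 0 := fun h0 => by
      have := congrArg QuadraticAlgebra.norm h0
      rw [map_mul, QuadraticAlgebra.norm_zero] at this
      have h1 : (t i₀).1 ≠ 0 := fun h => hi₀ (Subtype.ext h)
      rcases mul_eq_zero.1 this with h | h
      exacts [curve_norm_ne_zero hβ hnat h1 h, curve_norm_ne_zero hβ hnat hω h]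
    have hcard := card_curve_zeros_le hβ hnat hdeg hne hmem
    refine le_trans (Finset.card_le_card ?_) (hcard.trans ?_)
    · intro P hP
      simp only [Finset.mem_filter, Finset.mem_univ, true_and] at hP ⊢
      refine ⟨by rw [heval]; exact hP, ?_⟩
      rw [← hev P hP, map_mul, hev P hP, hev P hP]
      by_cases hPβ : P.1 * P.1 = β
      · simp only [eval_C, heval]
        rw [show -(2 * β) + (P.2 ^ p - P.2 + γ) * P.1 = 0 by linear_combination hPβ - hP, mul_zero]
      · rw [hex P hP hPβ i₀, zero_mul]
    · nlinarith

end CurveRing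

theorem AddSubgroup.exists_addChar_eq_one {A : Type*} [AddCommGroup A] [Finite A]
    {N : AddSubgroup A} (hN : N ≠ ⊤) : ∃ ψ : AddChar A ℂ, ψ ≠ 1 ∧ ∀ x ∈ N, ψ x = 1 := by
  obtain ⟨a, ha⟩ : ∃ a, a ∉ N := by
    by_contra! h
    exact hN (eq_top_iff.2 fun x _ => h x)
  have hne : (QuotientAddGroup.mk a : A ⧸ N) ≠ 0 := fun h =>
    ha ((QuotientAddGroup.eq_zero_iff a).1 h)
  obtain ⟨φ, hφ⟩ := AddChar.exists_apply_ne_zero.2 hne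
  refine ⟨φ.compAddMonoidHom (QuotientAddGroup.mk' N), ?_, fun x hx => ?_⟩
  · rw [AddChar.ne_one_iff]
    exact ⟨a, hφ⟩
  · rw [AddChar.compAddMonoidHom_apply, QuotientAddGroup.mk'_apply,
      (QuotientAddGroup.eq_zero_iff x).2 hx, AddChar.map_zero_eq_one]

/-! ### From point counts to Kloosterman sums -/

section Kloosterman

/-- The Kloosterman sum `∑ x ≠ 0, χ (x + b / x)` of a finite field. -/
noncomputable def kloostermanSum {F : Type*} [Field F] [Fintype F] [DecidableEq F]
    (χ : AddChar F ℂ) (b : F) : ℂ := ∑ x, if x = 0 then 0 else χ (x + b / x)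

/-- Each `y` and each `x ≠ 0` lie on the curve of exactly one `γ`, and there `χ γ = χ (x + b / x)`
since `χ` kills `y ^ p - y`. -/
theorem card_mul_kloostermanSum {K : Type*} [Field K] [Fintype K] [DecidableEq K] {p : ℕ}
    {χ : AddChar K ℂ} (hχ : ∀ y, χ (y ^ p - y) = 1) {b : K} (hb : b ≠ 0) :
    (Fintype.card K : ℂ) * kloostermanSum χ b = ∑ γ, χ γ * ((Finset.univ.filter
      fun P : K × K => P.1 * P.1 = (P.2 ^ p - P.2 + γ) * P.1 - b).card : ℂ) := by
  have h1 : ∀ γ, χ γ * ((Finset.univ.filter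
      fun P : K × K => P.1 * P.1 = (P.2 ^ p - P.2 + γ) * P.1 - b).card : ℂ) =
      ∑ x : K, ∑ y : K, if x * x = (y ^ p - y + γ) * x - b then χ γ else 0 := fun γ => by
    rw [← Finset.sum_product', Finset.univ_product_univ, ← Finset.sum_filter, Finset.sum_const,
      nsmul_eq_mul, mul_comm]
  simp_rw [h1]
  rw [Finset.sum_comm, kloostermanSum, Finset.mul_sum]
  refine Finset.sum_congr rfl fun x _ => ?_
  rw [Finset.sum_comm]
  split_ifs with hx
  · subst hx
    simp [eq_comm, hb]
  · have h2 : ∀ y γ : K, (x * x = (y ^ p - y + γ) * x - b) ↔ x + b / x - (y ^ p - y) = γ :=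
      fun y γ => by
        constructor
        · intro h; field_simp; linear_combination h
        · rintro rfl; field_simp; ring
    have h3 : ∀ y, χ (x + b / x - (y ^ p - y)) = χ (x + b / x) := fun y => by
      rw [AddChar.map_sub_eq_div, hχ, div_one]
    simp_rw [h2, Finset.sum_ite_eq, Finset.mem_univ, if_true, h3]
    rw [Finset.sum_const, Finset.card_univ, nsmul_eq_mul]

/-- Upper bounds on the point counts suffice. Since `χ` is nontrivial, `N γ` may be replaced by `N γ
- M`, which has constant sign, and `∑ N γ` is known exactly from the trivial character. -/
theorem norm_kloostermanSum_le_of_card {K : Type*} [Field K] [Fintype K] [DecidableEq K] {p m : ℕ}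
    [Fact p.Prime] [CharP K p] (hm : 0 < m) (hK : Fintype.card K = (p ^ m) ^ 2)
    (hpm : (p + 4) ^ 2 ≤ p ^ m) {χ : AddChar K ℂ} (hχ1 : χ ≠ 1)
    (hχ : ∀ y, χ (y ^ p - y) = 1) {b : K} (hb : b ≠ 0) :
    ‖kloostermanSum χ b‖ ≤ (2 * p + 5) * (p : ℝ) ^ m + 1 := by
  have hbound := fun γ => card_artinSchreier_curve_le hm hK hpm hb γ
  have h1 := card_mul_kloostermanSum hχ hb
  have h2 := card_mul_kloostermanSum (p := p) (χ := (1 : AddChar K ℂ)) (fun y => by simp) hb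
  have h3 : kloostermanSum (1 : AddChar K ℂ) b = Fintype.card K - 1 := by
    simp [kloostermanSum, Finset.sum_ite, Finset.filter_ne', Finset.card_erase_of_mem,
      Nat.cast_sub (Fintype.card_pos (α := K))]
  set N : K → ℕ := fun γ => (Finset.univ.filter
      fun P : K × K => P.1 * P.1 = (P.2 ^ p - P.2 + γ) * P.1 - b).card with hN
  set M : ℕ := (p ^ m) ^ 2 + (2 * p + 5) * p ^ m with hM
  have h4 : (∑ γ, (N γ : ℝ)) = Fintype.card K * (Fintype.card K - 1) := by
    rw [h3] at h2
    simp only [AddChar.one_apply, one_mul] at h2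
    exact_mod_cast h2.symm
  have h5 : (Fintype.card K : ℂ) * kloostermanSum χ b = ∑ γ, χ γ * ((N γ : ℂ) - M) := by
    simp_rw [mul_sub, Finset.sum_sub_distrib, ← Finset.sum_mul]
    rw [AddChar.sum_eq_zero_of_ne_one hχ1, zero_mul, sub_zero]
    exact h1
  have h6 : ‖(Fintype.card K : ℂ) * kloostermanSum χ b‖ ≤ ∑ γ, ((M : ℝ) - N γ) := by
    rw [h5]
    refine (norm_sum_le _ _).trans (Finset.sum_le_sum fun γ _ => ?_)
    rw [norm_mul, AddChar.norm_apply, one_mul]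
    have h7 : ((N γ : ℂ) - M) = (((N γ : ℝ) - M : ℝ) : ℂ) := by push_cast; rfl
    have h8 : (N γ : ℝ) ≤ M := by exact_mod_cast hbound γ
    rw [h7, Complex.norm_real, Real.norm_eq_abs, abs_sub_comm, abs_of_nonneg (by linarith)]
  rw [norm_mul, Finset.sum_sub_distrib, h4] at h6
  have hpos : (0 : ℝ) < Fintype.card K := by exact_mod_cast Fintype.card_pos
  simp only [Complex.norm_natCast, Finset.sum_const, Finset.card_univ, nsmul_eq_mul] at h6
  rw [← mul_sub] at h6
  have h9 := le_of_mul_le_mul_left h6 hpos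
  rw [hK, hM] at h9
  push_cast at h9
  linarith

end Kloosterman

/-! ### Kloosterman sums under quadratic extension -/

section QuadraticExtension

variable {F K : Type*} [Field F] [Fintype F] [Field K] [Fintype K] [Algebra F K]

theorem algebraMap_trace_of_finrank_two (h2 : Module.finrank F K = 2) (z : K) :
    algebraMap F K (Algebra.trace F K z) = z + z ^ Fintype.card F := by
  rw [FiniteField.algebraMap_trace_eq_sum_pow, h2, Nat.card_eq_fintype_card]
  simp [Finset.sum_range_succ]

theorem algebraMap_norm_of_finrank_two (h2 : Module.finrank F K = 2) (z : K) :
    algebraMap F K (Algebra.norm F z) = z * z ^ Fintype.card F := by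
  rw [FiniteField.algebraMap_norm_eq_prod_pow, h2, Nat.card_eq_fintype_card]
  simp [Finset.prod_range_succ]

variable [DecidableEq F] [DecidableEq K]

/-- The cases are those of `T² - t T + n`: irreducible, it has two conjugate roots in `K` and no
ordered pair in `F`; with distinct roots in `F`, two pairs and no `z`; with a double root, one of
each. -/
theorem card_trace_norm_fiber_add_le (h2 : Module.finrank F K = 2) (t n : F) :
    (Finset.univ.filter fun z : K => (Algebra.trace F K z, Algebra.norm F z) = (t, n)).card +
      (Finset.univ.filter fun P : F × F => (P.1 + P.2, P.1 * P.2) = (t, n)).card ≤ 2 := by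
  have hquad : ∀ z : K, Algebra.trace F K z = t → Algebra.norm F z = n →
      z * z - algebraMap F K t * z + algebraMap F K n = 0 := by
    rintro z rfl rfl
    rw [algebraMap_trace_of_finrank_two h2, algebraMap_norm_of_finrank_two h2]
    ring
  rcases Finset.eq_empty_or_nonempty
    (Finset.univ.filter fun P : F × F => (P.1 + P.2, P.1 * P.2) = (t, n)) with h0 | ⟨⟨x, y⟩, hxy⟩
  · rw [h0, Finset.card_empty, add_zero]
    rcases Finset.eq_empty_or_nonempty (Finset.univ.filter fun z : K =>
      (Algebra.trace F K z, Algebra.norm F z) = (t, n)) with h1 | ⟨w, hw⟩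
    · rw [h1]; simp
    · refine (Finset.card_le_card (t := {w, w ^ Fintype.card F}) ?_).trans Finset.card_le_two
      intro z hz
      simp only [Finset.mem_filter, Finset.mem_univ, true_and, Prod.mk.injEq] at hz hw
      have hz' := hquad z hz.1 hz.2
      rw [← hw.1, ← hw.2, algebraMap_trace_of_finrank_two h2,
        algebraMap_norm_of_finrank_two h2] at hz'
      have : (z - w) * (z - w ^ Fintype.card F) = 0 := by linear_combination hz'
      rcases mul_eq_zero.1 this with h | h <;> simp [sub_eq_zero.1 h]
  · simp only [Finset.mem_filter, Finset.mem_univ, true_and, Prod.mk.injEq] at hxy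
    obtain ⟨rfl, rfl⟩ := hxy
    have htr : ∀ a : F, Algebra.trace F K (algebraMap F K a) = a + a := fun a => by
      apply (algebraMap F K).injective
      rw [algebraMap_trace_of_finrank_two h2, ← map_pow, FiniteField.pow_card, map_add]
    have hK : ∀ z : K, (Algebra.trace F K z, Algebra.norm F z) = (x + y, x * y) →
        z = algebraMap F K x ∧ x = y := by
      intro z hz
      rw [Prod.mk.injEq] at hz
      have hz' := hquad z hz.1 hz.2
      rw [map_add, map_mul] at hz'
      have : (z - algebraMap F K x) * (z - algebraMap F K y) = 0 := by linear_combination hz'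
      rcases mul_eq_zero.1 this with h | h
      · have hzx := sub_eq_zero.1 h
        refine ⟨hzx, ?_⟩
        have := hz.1
        rw [hzx, htr] at this
        exact add_left_cancel this
      · have hzy := sub_eq_zero.1 h
        have := hz.1
        rw [hzy, htr] at this
        have := add_right_cancel this
        exact ⟨by rw [hzy, this], this.symm⟩
    have hF : (Finset.univ.filter fun P : F × F => (P.1 + P.2, P.1 * P.2) = (x + y, x * y)) ⊆
        {(x, y), (y, x)} := by
      rintro ⟨u, v⟩ huv
      simp only [Finset.mem_filter, Finset.mem_univ, true_and, Prod.mk.injEq] at huv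
      have : (u - x) * (u - y) = 0 := by linear_combination u * huv.1 - huv.2
      rcases mul_eq_zero.1 this with h | h
      · have hu := sub_eq_zero.1 h
        have hv : v = y := by linear_combination huv.1 - hu
        simp [hu, hv]
      · have hu := sub_eq_zero.1 h
        have hv : v = x := by linear_combination huv.1 - hu
        simp [hu, hv]
    by_cases hxy : x = y
    · subst hxy
      have h1 : (Finset.univ.filter fun z : K =>
          (Algebra.trace F K z, Algebra.norm F z) = (x + x, x * x)) ⊆ {algebraMap F K x} := by
        intro z hz
        rw [Finset.mem_filter] at hz
        simp [(hK z hz.2).1]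
      have h3 := Finset.card_le_card h1
      have h4 := Finset.card_le_card hF
      simp only [Finset.pair_eq_singleton, Finset.card_singleton] at h3 h4
      omega
    · have h1 : (Finset.univ.filter fun z : K =>
          (Algebra.trace F K z, Algebra.norm F z) = (x + y, x * y)) = ∅ :=
        Finset.filter_eq_empty_iff.2 fun z _ hz => hxy (hK z hz).2
      rw [h1, Finset.card_empty, zero_add]
      exact (Finset.card_le_card hF).trans Finset.card_le_two

/-- The bound 2 holds on each fibre, and the totals `|K| + |F|² = 2 |F|²` force equality everywhere.
-/
theorem card_trace_norm_fiber_add (h2 : Module.finrank F K = 2) (P : F × F) :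
    (Finset.univ.filter fun z : K => (Algebra.trace F K z, Algebra.norm F z) = P).card +
      (Finset.univ.filter fun R : F × F => (R.1 + R.2, R.1 * R.2) = P).card = 2 := by
  refine (Finset.sum_eq_sum_iff_of_le (s := Finset.univ) (g := fun _ => 2)
    (fun P _ => card_trace_norm_fiber_add_le h2 P.1 P.2)).1 ?_ P (Finset.mem_univ P)
  rw [Finset.sum_add_distrib,
    ← Finset.card_eq_sum_card_fiberwise (s := Finset.univ) (t := Finset.univ)
      (f := fun z : K => (Algebra.trace F K z, Algebra.norm F z)) (fun _ _ => by simp),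
    ← Finset.card_eq_sum_card_fiberwise (s := Finset.univ) (t := Finset.univ)
      (f := fun R : F × F => (R.1 + R.2, R.1 * R.2)) (fun _ _ => by simp)]
  simp only [Finset.card_univ, Finset.sum_const, Fintype.card_prod, smul_eq_mul]
  rw [Module.card_eq_pow_finrank (K := F) (V := K), h2]
  ring

theorem sum_comp_eq_sum_card_mul {ι κ : Type*} [Fintype ι] [Fintype κ] [DecidableEq κ]
    (g : ι → κ) (G : κ → ℂ) :
    ∑ i, G (g i) = ∑ P, ((Finset.univ.filter fun i => g i = P).card : ℂ) * G P := by
  rw [← Finset.sum_fiberwise (s := Finset.univ) (g := g)]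
  refine Finset.sum_congr rfl fun P _ => ?_
  rw [Finset.sum_congr rfl (g := fun _ => G P), Finset.sum_const, nsmul_eq_mul]
  intro i hi
  rw [(Finset.mem_filter.1 hi).2]

/-- A quadratic polynomial over `F` has as many roots in `F` as it lacks conjugate pairs of roots in
the quadratic extension `K`. -/
theorem sum_trace_norm_add_sum (h2 : Module.finrank F K = 2) (G : F × F → ℂ) :
    ∑ z : K, G (Algebra.trace F K z, Algebra.norm F z) + ∑ R : F × F, G (R.1 + R.2, R.1 * R.2) =
      2 * ∑ P, G P := by
  rw [sum_comp_eq_sum_card_mul (fun z : K => (Algebra.trace F K z, Algebra.norm F z)),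
    sum_comp_eq_sum_card_mul (fun R : F × F => (R.1 + R.2, R.1 * R.2)),
    ← Finset.sum_add_distrib, Finset.mul_sum]
  refine Finset.sum_congr rfl fun P _ => ?_
  rw [← add_mul]
  congr 1
  exact_mod_cast card_trace_norm_fiber_add h2 P

/-- Both `Tr (z + b / z)` and `x + b / x + y + b / y` have the form `t (1 + b / n)`, with `t, n` the
trace and norm, or the sum and product. In the sum over all `(t, n)`, summing over `t` kills every
`n` except `n = -b`. -/
theorem kloostermanSum_quadratic (h2 : Module.finrank F K = 2) {χ : AddChar F ℂ} (hχ : χ ≠ 1)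
    {b : F} (hb : b ≠ 0) :
    kloostermanSum (χ.compAddMonoidHom (Algebra.trace F K).toAddMonoidHom) (algebraMap F K b) +
      kloostermanSum χ b ^ 2 = 2 * Fintype.card F := by
  have key := sum_trace_norm_add_sum (K := K) h2
    (fun P => if P.2 = 0 then 0 else χ (P.1 * (1 + b / P.2)))
  have e1 : kloostermanSum (χ.compAddMonoidHom (Algebra.trace F K).toAddMonoidHom)
      (algebraMap F K b) = ∑ z : K, if Algebra.norm F z = 0 then 0 else
        χ (Algebra.trace F K z * (1 + b / Algebra.norm F z)) := by
    refine Finset.sum_congr rfl fun z _ => ?_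
    by_cases hz : z = 0
    · subst hz
      rw [if_pos rfl, if_pos]
      apply (algebraMap F K).injective
      rw [algebraMap_norm_of_finrank_two h2]; simp
    · have hn : algebraMap F K (Algebra.norm F z) ≠ 0 := by
        rw [algebraMap_norm_of_finrank_two h2]
        exact mul_ne_zero hz (pow_ne_zero _ hz)
      have hn' : Algebra.norm F z ≠ 0 := fun h => hn (by rw [h, map_zero])
      rw [if_neg hz, if_neg hn', AddChar.compAddMonoidHom_apply]
      congr 1
      apply (algebraMap F K).injective
      change algebraMap F K (Algebra.trace F K _) = _
      have hfrob : (z + algebraMap F K b / z) ^ Fintype.card F =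
          z ^ Fintype.card F + algebraMap F K b / z ^ Fintype.card F := by
        have := map_add (FiniteField.frobeniusAlgHom F K) z (algebraMap F K b / z)
        simp only [FiniteField.coe_frobeniusAlgHom] at this
        rw [this, div_pow, ← map_pow, FiniteField.pow_card]
      rw [algebraMap_trace_of_finrank_two h2, map_mul, map_add, map_one, map_div₀,
        algebraMap_norm_of_finrank_two h2, algebraMap_trace_of_finrank_two h2, hfrob]
      have := pow_ne_zero (Fintype.card F) hz
      field_simp
      ring
  have e2 : kloostermanSum χ b ^ 2 = ∑ R : F × F, if R.1 * R.2 = 0 then 0 else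
      χ ((R.1 + R.2) * (1 + b / (R.1 * R.2))) := by
    rw [pow_two, kloostermanSum, Finset.sum_mul_sum, ← Finset.sum_product',
      Finset.univ_product_univ]
    refine Finset.sum_congr rfl fun R _ => ?_
    by_cases h1 : R.1 = 0
    · simp [h1]
    by_cases h3 : R.2 = 0
    · simp [h3]
    rw [if_neg h1, if_neg h3, if_neg (mul_ne_zero h1 h3), ← AddChar.map_add_eq_mul]
    congr 1
    field_simp
    ring
  rw [e1, e2]
  rw [key]
  congr 1
  rw [Fintype.sum_prod_type_right]
  have e3 : ∀ n : F, (∑ t : F, if n = 0 then 0 else χ (t * (1 + b / n))) =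
      if -b = n then (Fintype.card F : ℂ) else 0 := fun n => by
    by_cases hn : n = 0
    · simp [hn, hb]
    simp only [hn, if_false]
    have := AddChar.sum_mulShift (1 + b / n) (AddChar.IsPrimitive.of_ne_one hχ)
    rw [this]
    have h4 : 1 + b / n = 0 ↔ -b = n := by
      constructor
      · intro h; field_simp at h; linear_combination -h
      · rintro rfl; field_simp; ring
    simp [h4]
  simp only [e3, Finset.sum_ite_eq, Finset.mem_univ, if_true]

end QuadraticExtension

/-! ### Weil's bound by amplification along a tower -/

section Weil

/-- `s` is the absolute value of a Kloosterman sum over a field with `Q` elements of characteristic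
`p`, for a character that factors through the trace to the prime field. -/
def IsKloostermanNorm (p Q : ℕ) (s : ℝ) : Prop :=
  ∃ (K : Type) (_ : Field K) (_ : Fintype K) (_ : DecidableEq K) (_ : CharP K p)
    (χ : AddChar K ℂ) (b : K), Fintype.card K = Q ∧ χ ≠ 1 ∧ (∀ y, χ (y ^ p - y) = 1) ∧ b ≠ 0 ∧
      ‖kloostermanSum χ b‖ = s

theorem isKloostermanNorm_sq {F : Type*} [Field F] [Fintype F] [DecidableEq F] {p : ℕ}
    [Fact p.Prime] [CharP F p] {χ : AddChar F ℂ} (hχ1 : χ ≠ 1) (hχ : ∀ y, χ (y ^ p - y) = 1)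
    {b : F} (hb : b ≠ 0) : ∃ s', IsKloostermanNorm p (Fintype.card F ^ 2) s' ∧
      ‖kloostermanSum χ b‖ ^ 2 - 2 * Fintype.card F ≤ s' := by
  classical
  let K := FiniteField.Extension F p 2
  let _ : Fintype K := Fintype.ofFinite K
  have h2 : Module.finrank F K = 2 := FiniteField.finrank_extension F p 2
  have hchar : CharP K p := charP_of_injective_algebraMap (algebraMap F K).injective p
  refine ⟨_, ⟨K, inferInstance, inferInstance, inferInstance, hchar,
    χ.compAddMonoidHom (Algebra.trace F K).toAddMonoidHom, algebraMap F K b, ?_, ?_, ?_, ?_, rfl⟩,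
    ?_⟩
  · rw [Module.card_eq_pow_finrank (K := F) (V := K), h2]
  · obtain ⟨x, hx⟩ := AddChar.ne_one_iff.1 hχ1
    obtain ⟨z, rfl⟩ := Algebra.trace_surjective F K x
    exact AddChar.ne_one_iff.2 ⟨z, hx⟩
  · intro y
    have : Algebra.trace F K (y ^ p - y) = Algebra.trace F K y ^ p - Algebra.trace F K y := by
      rw [map_sub]
      congr 1
      apply (algebraMap F K).injective
      rw [(algebraMap F K).map_pow, algebraMap_trace_of_finrank_two h2,
        algebraMap_trace_of_finrank_two h2, add_pow_char, ← pow_mul, ← pow_mul, mul_comm]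
    rw [AddChar.compAddMonoidHom_apply]
    change χ (Algebra.trace F K (y ^ p - y)) = 1
    rw [this, hχ]
  · exact (map_ne_zero _).2 hb
  · have := kloostermanSum_quadratic (K := K) h2 hχ1 hb
    rw [eq_sub_of_add_eq this, norm_sub_rev]
    refine le_trans (le_of_eq ?_) (norm_sub_norm_le _ _)
    rw [norm_pow, norm_mul, Complex.norm_natCast]
    simp

theorem IsKloostermanNorm.sq {p Q : ℕ} [Fact p.Prime] {s : ℝ} (h : IsKloostermanNorm p Q s) :
    ∃ s', IsKloostermanNorm p (Q ^ 2) s' ∧ s ^ 2 - 2 * Q ≤ s' := by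
  obtain ⟨K, _, _, _, _, χ, b, rfl, hχ1, hχ, hb, rfl⟩ := h
  exact isKloostermanNorm_sq hχ1 hχ hb

/-- With field size `Q²`, `s ≥ (2 + ε) Q` gives `s² - 2 Q² ≥ (2 + 4 ε) Q²`: each step at least
quadruples the excess. -/
theorem IsKloostermanNorm.tower {p q : ℕ} [Fact p.Prime] {s ε : ℝ} (hε : 0 ≤ ε)
    (h : IsKloostermanNorm p (q ^ 2) s) (hs : (2 + ε) * q ≤ s) (j : ℕ) :
    ∃ s', IsKloostermanNorm p ((q ^ 2 ^ j) ^ 2) s' ∧ (2 + 4 ^ j * ε) * (q : ℝ) ^ 2 ^ j ≤ s' := by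
  induction j with
  | zero => exact ⟨s, by simpa using h, by simpa using hs⟩
  | succ j ih =>
    obtain ⟨s₁, h₁, hs₁⟩ := ih
    obtain ⟨s₂, h₂, hs₂⟩ := h₁.sq
    refine ⟨s₂, ?_, le_trans ?_ hs₂⟩
    · rwa [pow_succ 2 j, pow_mul q]
    · have h4 : (0 : ℝ) ≤ 4 ^ j * ε := by positivity
      have hX : (0 : ℝ) ≤ (q : ℝ) ^ 2 ^ j := by positivity
      rw [pow_succ 2 j, pow_mul (q : ℝ), pow_succ (4 : ℝ) j]
      push_cast
      generalize (q : ℝ) ^ 2 ^ j = X at *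
      generalize (4 : ℝ) ^ j = Y at *
      have h5 : ((2 + Y * ε) * X) ^ 2 ≤ s₁ ^ 2 := by
        apply pow_le_pow_left₀ _ hs₁
        positivity
      nlinarith [mul_nonneg (sq_nonneg (Y * ε)) (sq_nonneg X)]

theorem IsKloostermanNorm.le {p m : ℕ} [Fact p.Prime] (hm : 0 < m) (hpm : (p + 4) ^ 2 ≤ p ^ m)
    {s : ℝ} (h : IsKloostermanNorm p ((p ^ m) ^ 2) s) : s ≤ (2 * p + 5) * (p : ℝ) ^ m + 1 := by
  obtain ⟨K, _, _, _, _, χ, b, hK, hχ1, hχ, hb, rfl⟩ := h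
  exact norm_kloostermanSum_le_of_card hm hK hpm hχ1 hχ hb

theorem norm_kloostermanSum_sq_le {F : Type*} [Field F] [Fintype F] [DecidableEq F] {p : ℕ}
    [Fact p.Prime] [CharP F p] {χ : AddChar F ℂ} (hχ1 : χ ≠ 1) (hχ : ∀ y, χ (y ^ p - y) = 1)
    {b : F} (hb : b ≠ 0) : ‖kloostermanSum χ b‖ ^ 2 ≤ 4 * Fintype.card F := by
  by_contra! hlt
  obtain ⟨s, h, hs⟩ := isKloostermanNorm_sq hχ1 hχ hb
  have hp1 : 1 < p := (Fact.out : p.Prime).one_lt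
  obtain ⟨n, -, hq⟩ := FiniteField.card F p
  set q := Fintype.card F with hqdef
  have hq0 : (0 : ℝ) < q := by exact_mod_cast Fintype.card_pos
  -- One quadratic extension has already been made, so the field has `q²` elements and the bound to
  -- violate is `2 q`.
  set ε := s / q - 2 with hεdef
  have hε : 0 < ε := by
    rw [hεdef, sub_pos, lt_div_iff₀ hq0]; linarith
  -- `j` must push the excess beyond `2 p + 6`, which absorbs the `+ 1` in the crude bound, and make
  -- the field large enough for that bound to apply.
  obtain ⟨j₁, hj₁⟩ := pow_unbounded_of_one_lt ((2 * p + 6 : ℝ) / ε) (by norm_num : (1 : ℝ) < 4)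
  set j := max j₁ ((p + 4) ^ 2) with hj
  obtain ⟨s', h', hs'⟩ := h.tower hε.le (by rw [hεdef]; field_simp; linarith) j
  have hqm : q ^ 2 ^ j = p ^ ((n : ℕ) * 2 ^ j) := by rw [hq, pow_mul]
  have hqmR : (q : ℝ) ^ 2 ^ j = (p : ℝ) ^ ((n : ℕ) * 2 ^ j) := by exact_mod_cast hqm
  have hj2 : (p + 4) ^ 2 ≤ p ^ ((n : ℕ) * 2 ^ j) := by
    calc (p + 4) ^ 2 ≤ j := le_max_right _ _
      _ ≤ 2 ^ j := Nat.lt_two_pow_self.le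
      _ ≤ (n : ℕ) * 2 ^ j := Nat.le_mul_of_pos_left _ n.pos
      _ ≤ p ^ ((n : ℕ) * 2 ^ j) := (Nat.lt_pow_self hp1).le
  rw [hqm] at h'
  have hle := h'.le (Nat.mul_pos n.pos (by positivity)) hj2
  rw [hqmR] at hs'
  have hX : (1 : ℝ) ≤ (p : ℝ) ^ ((n : ℕ) * 2 ^ j) :=
    one_le_pow₀ (by exact_mod_cast hp1.le)
  generalize (p : ℝ) ^ ((n : ℕ) * 2 ^ j) = X at *
  have h4 : (2 * p + 6 : ℝ) < 4 ^ j * ε := by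
    rw [div_lt_iff₀ hε] at hj₁
    refine hj₁.trans_le ?_
    gcongr
    · norm_num
    · exact le_max_left _ _
  nlinarith

/-- The additive map `y ↦ y ^ p - y` sends both `0` and `1` to `0`, so on a finite field it is not
surjective. -/
theorem exists_addChar_artinSchreier {F : Type*} [Field F] [Finite F] (p : ℕ) [Fact p.Prime]
    [CharP F p] : ∃ χ : AddChar F ℂ, χ ≠ 1 ∧ ∀ y, χ (y ^ p - y) = 1 := by
  have hp0 : p ≠ 0 := (Fact.out : p.Prime).ne_zero
  let f : F →+ F := (frobenius F p).toAddMonoidHom - AddMonoidHom.id F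
  have hf : ∀ y, f y = y ^ p - y := fun y => rfl
  have hN : f.range ≠ ⊤ := fun h => by
    have hinj := Finite.injective_iff_surjective.2 (AddMonoidHom.range_eq_top.1 h)
    exact one_ne_zero (hinj (by rw [hf, hf]; simp [hp0] : f 1 = f 0))
  obtain ⟨χ, h1, h2⟩ := AddSubgroup.exists_addChar_eq_one hN
  exact ⟨χ, h1, fun y => h2 _ ⟨y, hf y⟩⟩

theorem exists_mulShift_eq {F : Type*} [Field F] [Fintype F] {χ : AddChar F ℂ} (hχ : χ ≠ 1)
    (ψ : AddChar F ℂ) : ∃ a, AddChar.mulShift χ a = ψ := by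
  have hinj := AddChar.to_mulShift_inj_of_isPrimitive (AddChar.IsPrimitive.of_ne_one hχ)
  exact ((Fintype.bijective_iff_injective_and_card _).2 ⟨hinj, AddChar.card_eq.symm⟩).2 ψ

/-- Weil's bound for Kloosterman sums over a finite field. -/
theorem norm_sum_kloosterman_le {F : Type*} [Field F] [Fintype F] [DecidableEq F]
    {ψ : AddChar F ℂ} (hψ : ψ ≠ 1) {a b : F} (ha : a ≠ 0) (hb : b ≠ 0) :
    ‖∑ x : F, if x = 0 then 0 else ψ (a * x + b / x)‖ ≤ 2 * √(Fintype.card F : ℝ) := by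
  obtain ⟨p, hp⟩ := CharP.exists F
  have : Fact p.Prime := ⟨CharP.char_is_prime F p⟩
  obtain ⟨χ, hχ1, hχ⟩ := exists_addChar_artinSchreier (F := F) p
  obtain ⟨c, hc⟩ := exists_mulShift_eq hχ1 ψ
  have hc0 : c ≠ 0 := by
    rintro rfl
    exact hψ (by rw [← hc, AddChar.mulShift_zero])
  -- Writing `ψ` as the shift of `χ` by `c`, the substitution `x ↦ c a x` normalises the leading
  -- coefficient.
  have e : ∑ x : F, (if x = 0 then 0 else ψ (a * x + b / x)) =
      kloostermanSum χ (c * a * (c * b)) := by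
    refine Fintype.sum_equiv (Equiv.mulLeft₀ (c * a) (mul_ne_zero hc0 ha)) _ _ fun x => ?_
    by_cases hx : x = 0
    · simp [hx]
    · rw [Equiv.mulLeft₀_apply, if_neg hx, if_neg (mul_ne_zero (mul_ne_zero hc0 ha) hx), ← hc,
        AddChar.mulShift_apply]
      congr 1
      field_simp
  rw [e]
  have h := norm_kloostermanSum_sq_le hχ1 hχ
    (mul_ne_zero (mul_ne_zero hc0 ha) (mul_ne_zero hc0 hb))
  refine abs_le_of_sq_le_sq' ?_ (by positivity) |>.2
  rw [mul_pow, Real.sq_sqrt (by positivity)]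
  linarith

end Weil

/-! ### Spectra, independent sets and random walks of abelian Cayley graphs -/

section Cayley

variable {A : Type*} [AddCommGroup A]

/-- The eigenvalue at the character `ψ` of the Cayley graph with connection set `S = -S`. -/
noncomputable def cayleyEigenvalue (S : Finset A) (ψ : AddChar A ℂ) : ℝ := (∑ h ∈ S, ψ (-h)).re

variable {S : Finset A}

theorem cayleyEigenvalue_one : cayleyEigenvalue S 1 = S.card := by
  simp [cayleyEigenvalue]

variable [Fintype A]

/-- Negation on `S` conjugates the terms, so the sum is real and taking the real part loses nothing.
-/
theorem coe_cayleyEigenvalue (hS : ∀ h ∈ S, -h ∈ S) (ψ : AddChar A ℂ) :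
    (cayleyEigenvalue S ψ : ℂ) = ∑ h ∈ S, ψ (-h) := by
  rw [cayleyEigenvalue, ← Complex.conj_eq_iff_re, map_sum]
  refine Finset.sum_nbij' (fun h => -h) (fun h => -h) hS hS (by simp) (by simp) fun h _ => ?_
  rw [AddChar.map_neg_eq_conj ψ (-h)]

theorem abs_cayleyEigenvalue_le (ψ : AddChar A ℂ) : |cayleyEigenvalue S ψ| ≤ S.card := by
  refine (Complex.abs_re_le_norm _).trans ((norm_sum_le _ _).trans ?_)
  simp [AddChar.norm_apply]

theorem sum_sum_addChar_mul (hS : ∀ h ∈ S, -h ∈ S) [DecidableEq A] (a : A) :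
    ∑ ψ : AddChar A ℂ, (cayleyEigenvalue S ψ : ℂ) * ψ a =
      if a ∈ S then (Fintype.card A : ℂ) else 0 := by
  simp_rw [coe_cayleyEigenvalue hS, Finset.sum_mul, ← AddChar.map_add_eq_mul]
  rw [Finset.sum_comm]
  simp_rw [AddChar.sum_apply_eq_ite, neg_add_eq_zero]
  rw [Finset.sum_ite_eq' S a]

theorem sum_cayleyEigenvalue_mul_normSq (hS : ∀ h ∈ S, -h ∈ S) [DecidableEq A] (T : Finset A) :
    ∑ ψ : AddChar A ℂ, cayleyEigenvalue S ψ * Complex.normSq (∑ x ∈ T, ψ x) =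
      Fintype.card A * ((T ×ˢ T).filter fun P => P.1 - P.2 ∈ S).card := by
  have h1 : ∀ ψ : AddChar A ℂ, (Complex.normSq (∑ x ∈ T, ψ x) : ℂ) =
      ∑ P ∈ T ×ˢ T, ψ (P.1 - P.2) := fun ψ => by
    rw [Complex.normSq_eq_conj_mul_self, mul_comm, map_sum, Finset.sum_mul_sum,
      ← Finset.sum_product']
    refine Finset.sum_congr rfl fun P _ => ?_
    rw [sub_eq_add_neg, AddChar.map_add_eq_mul, AddChar.map_neg_eq_conj]
  apply Complex.ofReal_injective
  push_cast
  simp_rw [h1, Finset.mul_sum]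
  rw [Finset.sum_comm]
  simp_rw [sum_sum_addChar_mul hS]
  rw [← Finset.sum_filter, Finset.sum_const, nsmul_eq_mul, mul_comm]

/-- Parseval, read off from the preceding identity with `S = {0}`. -/
theorem sum_normSq_addChar (T : Finset A) :
    ∑ ψ : AddChar A ℂ, Complex.normSq (∑ x ∈ T, ψ x) = Fintype.card A * T.card := by
  classical
  have := sum_cayleyEigenvalue_mul_normSq (S := {(0 : A)}) (by simp) T
  have h1 : ∀ ψ : AddChar A ℂ, cayleyEigenvalue {(0 : A)} ψ = 1 := fun ψ => by
    simp [cayleyEigenvalue]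
  simp only [h1, one_mul] at this
  rw [this]
  congr 2
  refine Finset.card_nbij' (fun P => P.1) (fun x => (x, x)) ?_ ?_ ?_ ?_
  · intro P hP; simp at hP; exact hP.1.1
  · intro x hx; simpa using hx
  · rintro ⟨x, y⟩ hP
    simp [sub_eq_zero] at hP
    simp [hP.2]
  · intro x _; rfl

/-- Hoffman's ratio bound for Cayley graphs. -/
theorem card_mul_card_le_of_indep (hS : ∀ h ∈ S, -h ∈ S) {Λ : ℝ}
    (hΛ : ∀ ψ : AddChar A ℂ, ψ ≠ 1 → |cayleyEigenvalue S ψ| ≤ Λ) (hΛ0 : 0 ≤ Λ) {T : Finset A}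
    (hT : ∀ x ∈ T, ∀ y ∈ T, x - y ∉ S) : (S.card : ℝ) * T.card ≤ Λ * Fintype.card A := by
  classical
  rcases T.eq_empty_or_nonempty with rfl | hne
  · simp; positivity
  have h1 := sum_cayleyEigenvalue_mul_normSq hS T
  have h2 := sum_normSq_addChar T
  have h3 : ((T ×ˢ T).filter fun P => P.1 - P.2 ∈ S) = ∅ :=
    Finset.filter_eq_empty_iff.2 fun P hP => by
      rw [Finset.mem_product] at hP
      exact hT _ hP.1 _ hP.2
  rw [h3, Finset.card_empty, Nat.cast_zero, mul_zero,
    ← Finset.add_sum_erase _ _ (Finset.mem_univ (1 : AddChar A ℂ)), cayleyEigenvalue_one] at h1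
  rw [← Finset.add_sum_erase _ _ (Finset.mem_univ (1 : AddChar A ℂ))] at h2
  have h4 : Complex.normSq (∑ x ∈ T, (1 : AddChar A ℂ) x) = (T.card : ℝ) * T.card := by
    simp
  rw [h4] at h1 h2
  have h5 : -∑ ψ ∈ Finset.univ.erase (1 : AddChar A ℂ),
      cayleyEigenvalue S ψ * Complex.normSq (∑ x ∈ T, ψ x) ≤
      Λ * ∑ ψ ∈ Finset.univ.erase (1 : AddChar A ℂ), Complex.normSq (∑ x ∈ T, ψ x) := by
    rw [Finset.mul_sum, ← Finset.sum_neg_distrib]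
    refine Finset.sum_le_sum fun ψ hψ => ?_
    rw [← neg_mul]
    refine mul_le_mul_of_nonneg_right ?_ (Complex.normSq_nonneg _)
    exact (neg_le_abs _).trans (hΛ ψ (Finset.ne_of_mem_erase hψ))
  have hpos : (0 : ℝ) < T.card := by exact_mod_cast hne.card_pos
  -- The gain `Λ |T|²` from omitting the trivial character is discarded.
  have h6 : (S.card : ℝ) * T.card * T.card ≤ Λ * Fintype.card A * T.card := by
    nlinarith [mul_nonneg hΛ0 (mul_nonneg hpos.le hpos.le)]
  exact le_of_mul_le_mul_right h6 hpos

variable {G : SimpleGraph A} [DecidableRel G.Adj]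

theorem degree_cayley (hG : ∀ x y, G.Adj x y ↔ x - y ∈ S) (x : A) : G.degree x = S.card := by
  rw [← SimpleGraph.card_neighborFinset_eq_degree]
  refine Finset.card_nbij' (fun y => x - y) (fun h => x - h) ?_ ?_ ?_ ?_
  · intro y hy
    simpa [hG] using hy
  · intro h hh
    simpa [hG] using hh
  · intro y _; simp
  · intro y _; simp

variable [DecidableEq A]

theorem adjMatrix_mulVec_addChar (hS : ∀ h ∈ S, -h ∈ S) (hG : ∀ x y, G.Adj x y ↔ x - y ∈ S)
    (ψ : AddChar A ℂ) :
    (G.adjMatrix ℂ).mulVec ψ = (cayleyEigenvalue S ψ : ℂ) • (ψ : A → ℂ) := by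
  ext x
  rw [coe_cayleyEigenvalue hS, Matrix.mulVec, dotProduct, Pi.smul_apply, smul_eq_mul,
    Finset.sum_mul]
  simp only [SimpleGraph.adjMatrix_apply, ite_mul, one_mul, zero_mul, hG]
  rw [← Finset.sum_filter]
  refine Finset.sum_nbij' (fun y => x - y) (fun h => x - h) ?_ ?_ (by simp) (by simp) ?_
  · intro y hy; simpa using hy
  · intro y hy; simpa using hy
  · intro y _
    rw [← AddChar.map_add_eq_mul]
    congr 1; abel

open Polynomial in
-- Over `ℂ` the characters form a basis diagonalising the adjacency matrix; the identity descends to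
-- `ℝ` because the eigenvalues are real.
theorem charpoly_adjMatrix_cayley (hS : ∀ h ∈ S, -h ∈ S) (hG : ∀ x y, G.Adj x y ↔ x - y ∈ S) :
    (G.adjMatrix ℝ).charpoly = ∏ ψ : AddChar A ℂ, (X - C (cayleyEigenvalue S ψ)) := by
  classical
  apply Polynomial.map_injective _ Complex.ofRealHom.injective
  rw [← Matrix.charpoly_map, Polynomial.map_prod]
  have h1 : (G.adjMatrix ℝ).map Complex.ofRealHom = G.adjMatrix ℂ := by
    ext x y
    simp [SimpleGraph.adjMatrix_apply]
  rw [h1, ← Matrix.charpoly_toLin',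
    ← LinearMap.charpoly_toMatrix _ (AddChar.complexBasis A)]
  have h2 : LinearMap.toMatrix (AddChar.complexBasis A) (AddChar.complexBasis A)
      (G.adjMatrix ℂ).toLin' = Matrix.diagonal fun ψ => (cayleyEigenvalue S ψ : ℂ) := by
    ext φ ψ
    rw [LinearMap.toMatrix_apply, AddChar.complexBasis_apply, Matrix.toLin'_apply,
      adjMatrix_mulVec_addChar hS hG, ← AddChar.complexBasis_apply, map_smul,
      Module.Basis.repr_self]
    simp [Finsupp.single_apply, Matrix.diagonal_apply, eq_comm]
    aesop
  rw [h2, Matrix.charpoly_diagonal]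
  simp

theorem graphSpectrum_cayley (hS : ∀ h ∈ S, -h ∈ S) (hG : ∀ x y, G.Adj x y ↔ x - y ∈ S) :
    graphSpectrum G = (Finset.univ : Finset (AddChar A ℂ)).val.map (cayleyEigenvalue S) := by
  have h := Polynomial.roots_multiset_prod_X_sub_C
    ((Finset.univ : Finset (AddChar A ℂ)).val.map (cayleyEigenvalue S))
  rw [Multiset.map_map] at h
  rw [graphSpectrum, charpoly_adjMatrix_cayley hS hG]
  exact h

/-- The trivial character and a maximising `φ` are split off the multiset; each dominates what
remains, so they head the sorted list. -/
theorem spectralGap_cayley (hS : ∀ h ∈ S, -h ∈ S) (hG : ∀ x y, G.Adj x y ↔ x - y ∈ S) {Λ : ℝ}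
    (hΛ : ∀ ψ : AddChar A ℂ, ψ ≠ 1 → |cayleyEigenvalue S ψ| ≤ Λ)
    (hΛ' : ∃ ψ : AddChar A ℂ, ψ ≠ 1 ∧ |cayleyEigenvalue S ψ| = Λ) :
    spectralGap G = S.card - Λ := by
  classical
  obtain ⟨φ, hφ, rfl⟩ := hΛ'
  have h1 : (Finset.univ : Finset (AddChar A ℂ)).val =
      1 ::ₘ φ ::ₘ ((Finset.univ.erase 1).erase φ).val := by
    rw [← Finset.insert_val_of_notMem (by simp), Finset.insert_erase (by simp [hφ]),
      ← Finset.insert_val_of_notMem (by simp), Finset.insert_erase (by simp)]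
  have h2 : eigenvalueMagnitudes G = (S.card : ℝ) :: |cayleyEigenvalue S φ| ::
      (((Finset.univ.erase 1).erase φ).val.map fun ψ => |cayleyEigenvalue S ψ|).sort
        (· ≥ ·) := by
    rw [eigenvalueMagnitudes, graphSpectrum_cayley hS hG, Multiset.map_map, h1, Multiset.map_cons,
      Multiset.map_cons, Multiset.sort_cons, Multiset.sort_cons]
    · simp only [Function.comp_apply, cayleyEigenvalue_one, Nat.abs_cast]
    · intro b hb
      obtain ⟨ψ, hψ, rfl⟩ := Multiset.mem_map.1 hb
      have hψ' := Finset.mem_erase.1 hψ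
      exact hΛ ψ (Finset.ne_of_mem_erase hψ'.2)
    · intro b hb
      rw [← Multiset.map_cons (fun ψ : AddChar A ℂ => ((fun l : ℝ => |l|) ∘ cayleyEigenvalue S) ψ)] at hb
      obtain ⟨ψ, -, rfl⟩ := Multiset.mem_map.1 hb
      simp only [Function.comp_apply, cayleyEigenvalue_one, Nat.abs_cast]
      exact abs_cayleyEigenvalue_le ψ
  rw [spectralGap, h2]
  simp

/-- At `t = 0` this is the character expansion of a point mass; each step multiplies the coefficient
at `ψ` by its normalised eigenvalue. -/
theorem walkProb_cayley (hS : ∀ h ∈ S, -h ∈ S) (hG : ∀ x y, G.Adj x y ↔ x - y ∈ S) (t : ℕ)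
    (x y : A) : (walkProb G t x y : ℂ) = (Fintype.card A : ℂ)⁻¹ *
      ∑ ψ : AddChar A ℂ, ((cayleyEigenvalue S ψ : ℂ) / S.card) ^ t * ψ (x - y) := by
  have hcard : (Fintype.card A : ℂ) ≠ 0 := Nat.cast_ne_zero.2 Fintype.card_ne_zero
  unfold walkProb
  induction t generalizing y with
  | zero =>
    simp only [pow_zero, one_mul]
    rw [AddChar.sum_apply_eq_ite, Matrix.one_apply]
    by_cases h : x = y <;> simp [h, sub_eq_zero]
  | succ t ih =>
    rw [pow_succ, Matrix.mul_apply]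
    push_cast
    simp_rw [ih]
    have h1 : ∀ z, ((walkMatrix G z y : ℝ) : ℂ) = if z - y ∈ S then (S.card : ℂ)⁻¹ else 0 :=
      fun z => by
        rw [walkMatrix, degree_cayley hG]
        simp only [hG]
        split_ifs <;> simp
    simp_rw [h1, mul_assoc, Finset.sum_mul, ← Finset.mul_sum]
    congr 1
    rw [Finset.sum_comm]
    refine Finset.sum_congr rfl fun ψ _ => ?_
    simp only [mul_ite, mul_zero]
    rw [← Finset.sum_filter]
    have h2 : ((cayleyEigenvalue S ψ : ℂ) / S.card) ^ (t + 1) * ψ (x - y) =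
        ∑ h ∈ S, ((cayleyEigenvalue S ψ : ℂ) / S.card) ^ t * ψ (x - y - h) * (S.card : ℂ)⁻¹ := by
      have h3 : ∑ h ∈ S, ψ (x - y - h) = cayleyEigenvalue S ψ * ψ (x - y) := by
        rw [coe_cayleyEigenvalue hS, Finset.sum_mul]
        refine Finset.sum_congr rfl fun h _ => ?_
        rw [← AddChar.map_add_eq_mul]
        congr 1; abel
      rw [← Finset.sum_mul, ← Finset.mul_sum, h3, pow_succ]
      ring
    rw [h2]
    refine Finset.sum_nbij' (fun z => z - y) (fun h => y + h) ?_ ?_ (by simp) (by simp) ?_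
    · intro z hz; simpa using hz
    · intro z hz; simpa using hz
    · intro z _
      congr 3; abel

theorem abs_walkProb_sub_le (hS : ∀ h ∈ S, -h ∈ S) (hG : ∀ x y, G.Adj x y ↔ x - y ∈ S)
    (hS0 : S.Nonempty) {Λ : ℝ} (hΛ : ∀ ψ : AddChar A ℂ, ψ ≠ 1 → |cayleyEigenvalue S ψ| ≤ Λ)
    (hΛ0 : 0 ≤ Λ) (t : ℕ) (x y : A) :
    |walkProb G t x y - 1 / Fintype.card A| ≤ (Λ / S.card) ^ t := by
  classical
  have hc : (0 : ℝ) < Fintype.card A := by exact_mod_cast Fintype.card_pos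
  have hd : (S.card : ℂ) ≠ 0 := Nat.cast_ne_zero.2 hS0.card_pos.ne'
  have h1 : ((walkProb G t x y - 1 / Fintype.card A : ℝ) : ℂ) = (Fintype.card A : ℂ)⁻¹ *
      ∑ ψ ∈ Finset.univ.erase (1 : AddChar A ℂ),
        ((cayleyEigenvalue S ψ : ℂ) / S.card) ^ t * ψ (x - y) := by
    push_cast
    rw [walkProb_cayley hS hG, ← Finset.add_sum_erase _ _ (Finset.mem_univ (1 : AddChar A ℂ)),
      cayleyEigenvalue_one]
    push_cast
    rw [div_self hd]
    simp
    ring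
  rw [← Real.norm_eq_abs, ← Complex.norm_real, h1, norm_mul, norm_inv, Complex.norm_natCast]
  have h2 : ‖∑ ψ ∈ Finset.univ.erase (1 : AddChar A ℂ),
      ((cayleyEigenvalue S ψ : ℂ) / S.card) ^ t * ψ (x - y)‖ ≤
        Fintype.card A * (Λ / S.card) ^ t := by
    have h3 : (Finset.univ.erase (1 : AddChar A ℂ)).card ≤ Fintype.card A := by
      rw [← AddChar.card_eq (α := A)]
      exact Finset.card_le_univ _
    refine (norm_sum_le _ _).trans ((Finset.sum_le_card_nsmul _ _ ((Λ / S.card) ^ t)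
      fun ψ hψ => ?_).trans ?_)
    · rw [norm_mul, AddChar.norm_apply, mul_one, norm_pow, norm_div, Complex.norm_natCast,
        Complex.norm_real, Real.norm_eq_abs]
      gcongr
      exact hΛ ψ (Finset.ne_of_mem_erase hψ)
    · rw [nsmul_eq_mul]
      gcongr
  calc (Fintype.card A : ℝ)⁻¹ * _ ≤ (Fintype.card A : ℝ)⁻¹ * (Fintype.card A * (Λ / S.card) ^ t) := by
        gcongr
    _ = _ := by field_simp

end Cayley

/-! ### Extreme eigenvalues, connectivity and bipartiteness -/

section Connectivity

theorem Complex.eq_one_of_re_eq_one {z : ℂ} (h : ‖z‖ = 1) (hre : z.re = 1) : z = 1 := by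
  have h1 := Complex.normSq_eq_norm_sq z
  rw [h, Complex.normSq_apply, hre] at h1
  exact Complex.ext hre (by simpa using h1)

variable {A : Type*} [AddCommGroup A] {S : Finset A}

theorem addChar_eq_one_of_cayleyEigenvalue_eq [Fintype A] (hS : ∀ h ∈ S, -h ∈ S) {ψ : AddChar A ℂ}
    (h : cayleyEigenvalue S ψ = S.card) : ∀ x ∈ S, ψ x = 1 := by
  have hle : ∀ x ∈ S, (ψ (-x)).re ≤ 1 := fun x _ =>
    (Complex.re_le_norm _).trans (AddChar.norm_apply ψ (-x)).le
  have h1 : ∑ x ∈ S, (ψ (-x)).re = ∑ x ∈ S, (1 : ℝ) := by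
    rw [cayleyEigenvalue, Complex.re_sum] at h
    rw [h]; simp
  have h2 := (Finset.sum_eq_sum_iff_of_le hle).1 h1
  intro x hx
  have := Complex.eq_one_of_re_eq_one (AddChar.norm_apply ψ _) (h2 (-x) (hS x hx))
  rwa [neg_neg] at this

theorem addChar_eq_neg_one_of_cayleyEigenvalue_eq [Fintype A] (hS : ∀ h ∈ S, -h ∈ S) {ψ : AddChar A ℂ}
    (h : cayleyEigenvalue S ψ = -S.card) : ∀ x ∈ S, ψ x = -1 := by
  have hle : ∀ x ∈ S, (-ψ (-x)).re ≤ 1 := fun x _ =>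
    (Complex.re_le_norm _).trans (by rw [norm_neg]; exact (AddChar.norm_apply ψ (-x)).le)
  have h1 : ∑ x ∈ S, (-ψ (-x)).re = ∑ x ∈ S, (1 : ℝ) := by
    rw [cayleyEigenvalue, Complex.re_sum] at h
    simp only [Complex.neg_re, Finset.sum_neg_distrib, h]; simp
  have h2 := (Finset.sum_eq_sum_iff_of_le hle).1 h1
  intro x hx
  have := Complex.eq_one_of_re_eq_one (by rw [norm_neg]; exact AddChar.norm_apply ψ _)
    (h2 (-x) (hS x hx))
  rw [neg_neg] at this
  rw [← this, neg_neg]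

variable {G : SimpleGraph A}

/-- Equality in the triangle inequality makes `ψ` either constant along edges, hence trivial, or
sign-changing along edges, hence a 2-colouring. -/
theorem abs_cayleyEigenvalue_lt_of_connected [Fintype A] (hS : ∀ h ∈ S, -h ∈ S)
    (hG : ∀ x y, G.Adj x y ↔ x - y ∈ S) (hconn : G.Connected) (hbip : ¬ G.IsBipartite)
    {ψ : AddChar A ℂ} (hψ : ψ ≠ 1) : |cayleyEigenvalue S ψ| < S.card := by
  classical
  by_contra! hle
  have heq := le_antisymm (abs_cayleyEigenvalue_le ψ) hle
  rcases eq_or_eq_neg_of_abs_eq heq with h | h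
  · have h1 := addChar_eq_one_of_cayleyEigenvalue_eq hS h
    have hadj : ∀ x y, G.Walk x y → ψ x = ψ y := by
      intro x y w
      induction w with
      | nil => rfl
      | cons hxy _ ih =>
        rw [← ih]
        have := h1 _ ((hG _ _).1 hxy)
        rw [AddChar.map_sub_eq_div] at this
        exact eq_of_div_eq_one this
    refine hψ (AddChar.eq_one_iff.2 fun x => ?_)
    obtain ⟨w⟩ := hconn.preconnected x 0
    rw [hadj x 0 w, AddChar.map_zero_eq_one]
  · have h1 := addChar_eq_neg_one_of_cayleyEigenvalue_eq hS h
    have hadj : ∀ x y, G.Adj x y → ψ x = -ψ y := fun x y hxy => by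
      have := h1 _ ((hG _ _).1 hxy)
      rw [AddChar.map_sub_eq_div, div_eq_iff (AddChar.val_isUnit ψ y).ne_zero] at this
      rw [this, neg_one_mul]
    have hwalk : ∀ x y, G.Walk x y → (ψ x = ψ y ∨ ψ x = -ψ y) := by
      intro x y w
      induction w with
      | nil => exact Or.inl rfl
      | cons hxy _ ih =>
        rw [hadj _ _ hxy]
        rcases ih with h | h <;> rw [h] <;> simp
    have hpm : ∀ x, ψ x = 1 ∨ ψ x = -1 := fun x => by
      obtain ⟨w⟩ := hconn.preconnected x 0
      simpa using hwalk x 0 w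
    refine hbip ?_
    have C : G.Coloring Bool := SimpleGraph.Coloring.mk (fun x => decide (ψ x = 1)) (by
      intro x y hxy h
      have h2 := hadj x y hxy
      have h3 := decide_eq_decide.1 h
      have h4 : (-1 : ℂ) ≠ 1 := by norm_num
      rcases hpm y with hy | hy
      · rw [hy] at h2
        exact h4 (h2 ▸ h3.2 hy)
      · rw [hy, neg_neg] at h2
        exact h4 (hy ▸ h3.1 h2))
    exact C.colorable

theorem connected_of_closure_eq_top (hS : ∀ h ∈ S, -h ∈ S) (hG : ∀ x y, G.Adj x y ↔ x - y ∈ S)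
    (htop : AddSubgroup.closure (S : Set A) = ⊤) : G.Connected := by
  have key : ∀ x ∈ AddSubgroup.closure (S : Set A), ∀ y, G.Reachable y (y + x) := by
    intro x hx
    induction hx using AddSubgroup.closure_induction with
    | mem h hh =>
      intro y
      refine SimpleGraph.Adj.reachable ((hG _ _).2 ?_)
      simpa using hS h hh
    | zero => intro y; rw [add_zero]
    | add a b _ _ ha hb =>
      intro y
      rw [← add_assoc]
      exact (ha y).trans (hb (y + a))
    | neg a _ ha =>
      intro y
      have := (ha (y + -a)).symm
      rwa [neg_add_cancel_right] at this
  refine { preconnected := fun x y => ?_, nonempty := ⟨0⟩ }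
  have := key (y - x) (by rw [htop]; trivial) x
  rwa [add_sub_cancel] at this

/-- Since `S` generates, each translation either preserves or swaps the two colours. The resulting
sign is multiplicative. -/
theorem exists_addChar_of_bipartite (hG : ∀ x y, G.Adj x y ↔ x - y ∈ S)
    (htop : AddSubgroup.closure (S : Set A) = ⊤) (hbip : G.IsBipartite) :
    ∃ ψ : AddChar A ℂ, ∀ h ∈ S, ψ h = -1 := by
  classical
  obtain ⟨c⟩ := hbip
  have hfin : ∀ {i j k : Fin 2}, i ≠ j → k ≠ j → i = k := by decide
  have key : ∀ x, (∀ y, c (y + x) = c y) ∨ (∀ y, c (y + x) ≠ c y) := by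
    intro x
    have hx : x ∈ AddSubgroup.closure (S : Set A) := by rw [htop]; trivial
    induction hx using AddSubgroup.closure_induction with
    | mem h hh =>
      exact Or.inr fun y => c.valid ((hG _ _).2 (by simpa using hh))
    | zero => exact Or.inl fun y => by rw [add_zero]
    | add a b _ _ ha hb =>
      rcases ha with ha | ha <;> rcases hb with hb | hb
      · exact Or.inl fun y => by rw [← add_assoc, hb, ha]
      · exact Or.inr fun y => by rw [← add_assoc, ← ha y]; exact hb _
      · exact Or.inr fun y => by rw [← add_assoc, hb]; exact ha _
      · exact Or.inl fun y => by
          rw [← add_assoc]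
          exact hfin (hb _) (ha y).symm
    | neg a _ ha =>
      rcases ha with ha | ha
      · exact Or.inl fun y => by rw [← ha (y + -a), neg_add_cancel_right]
      · exact Or.inr fun y => by
          have := ha (y + -a)
          rw [neg_add_cancel_right] at this
          exact this.symm
  let ψ : AddChar A ℂ :=
    { toFun := fun x => if c x = c 0 then 1 else -1
      map_zero_eq_one' := if_pos rfl
      map_add_eq_mul' := fun x y => by
        rcases key x with hx | hx
        · have h0 := hx 0
          rw [zero_add] at h0
          rw [add_comm x y, hx y, if_pos h0, one_mul]
        · have h0 := hx 0
          rw [zero_add] at h0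
          have hy := hx y
          rw [add_comm x y, if_neg h0]
          by_cases h : c y = c 0
          · rw [h] at hy
            rw [if_neg hy, if_pos h, mul_one]
          · rw [if_pos (hfin hy (Ne.symm h)), if_neg h]; norm_num }
  refine ⟨ψ, fun h hh => ?_⟩
  have : c h ≠ c 0 := c.valid ((hG _ _).2 (by simpa using hh))
  exact if_neg this

theorem connected_and_not_bipartite_iff [Fintype A] (hS : ∀ h ∈ S, -h ∈ S)
    (hG : ∀ x y, G.Adj x y ↔ x - y ∈ S) (hS0 : S.Nonempty) :
    (G.Connected ∧ ¬ G.IsBipartite) ↔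
      ∀ ψ : AddChar A ℂ, ψ ≠ 1 → |cayleyEigenvalue S ψ| < S.card := by
  refine ⟨fun h ψ hψ => abs_cayleyEigenvalue_lt_of_connected hS hG h.1 h.2 hψ, fun h => ?_⟩
  have htop : AddSubgroup.closure (S : Set A) = ⊤ := by
    by_contra hne
    obtain ⟨ψ, hψ, hψS⟩ := AddSubgroup.exists_addChar_eq_one hne
    refine (h ψ hψ).ne ?_
    rw [cayleyEigenvalue, Finset.sum_congr rfl fun x hx =>
      hψS (-x) (AddSubgroup.subset_closure (hS x hx))]
    simp
  refine ⟨connected_of_closure_eq_top hS hG htop, fun hbip => ?_⟩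
  obtain ⟨ψ, hψ⟩ := exists_addChar_of_bipartite hG htop hbip
  have hne : ψ ≠ 1 := by
    rintro rfl
    obtain ⟨x, hx⟩ := hS0
    have := hψ x hx
    norm_num at this
  refine (h ψ hne).ne ?_
  rw [cayleyEigenvalue, Finset.sum_congr rfl fun x hx => hψ (-x) (hS x hx)]
  simp

/-- As `0 ∉ S` the eigenvalues sum to zero, while the trivial one is `|S| > 0`. This makes the
Kloosterman–Salem number positive. -/
theorem exists_cayleyEigenvalue_ne_zero [Fintype A] (hS : ∀ h ∈ S, -h ∈ S) (hS0 : S.Nonempty)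
    (h0 : (0 : A) ∉ S) : ∃ ψ : AddChar A ℂ, ψ ≠ 1 ∧ cayleyEigenvalue S ψ ≠ 0 := by
  classical
  by_contra! h
  have h1 := sum_sum_addChar_mul hS (0 : A)
  rw [if_neg h0, Finset.sum_eq_single_of_mem 1 (Finset.mem_univ _) fun ψ _ hψ => by
    rw [h ψ hψ]; simp, cayleyEigenvalue_one] at h1
  simp at h1
  exact hS0.ne_empty h1

theorem card_le_mul_indepNum {V : Type*} [Fintype V] {G : SimpleGraph V} {k : ℕ}
    (h : G.Colorable k) : Fintype.card V ≤ k * G.indepNum := by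
  classical
  obtain ⟨c⟩ := h
  have := Finset.card_le_mul_card_image_of_maps_to (s := (Finset.univ : Finset V))
    (t := (Finset.univ : Finset (Fin k))) (f := c) (fun _ _ => Finset.mem_univ _) G.indepNum
    (fun i _ => by
      refine SimpleGraph.IsIndepSet.card_le_indepNum ?_
      intro v hv w hw _ hvw
      simp only [Finset.coe_filter, Finset.mem_univ, true_and, Set.mem_ofPred_eq] at hv hw
      exact c.valid hvw (hv.trans hw.symm))
  simpa [mul_comm] using this

end Connectivity

/-! ### The hyperbola and the Kloosterman–Salem number -/

section Hyperbola

/-- The hyperbola of a finite ring as a finset. -/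
def hyperbolaFinset (R : Type*) [Ring R] [Fintype R] [DecidableEq R] : Finset (R × R) :=
  Finset.univ.filter fun P => P.1 * P.2 = 1

theorem sqrt_card_units_pos (R : Type*) [Ring R] [Fintype R] : 0 < √(Nat.card Rˣ : ℝ) :=
  Real.sqrt_pos.2 (Nat.cast_pos.2 Nat.card_pos)

variable {R : Type*} [Ring R] [Fintype R] [DecidableEq R]

theorem mem_hyperbolaFinset {P : R × R} : P ∈ hyperbolaFinset R ↔ P.1 * P.2 = 1 := by
  simp [hyperbolaFinset]

theorem neg_mem_hyperbolaFinset : ∀ P ∈ hyperbolaFinset R, -P ∈ hyperbolaFinset R := fun P hP => by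
  rw [mem_hyperbolaFinset] at *
  simpa using hP

theorem hyperbolaFinset_nonempty : (hyperbolaFinset R).Nonempty :=
  ⟨(1, 1), mem_hyperbolaFinset.2 (mul_one 1)⟩

theorem hyperbolaGraph_adj_iff [Nontrivial R] (x y : R × R) :
    (hyperbolaGraph R).Adj x y ↔ x - y ∈ hyperbolaFinset R :=
  mem_hyperbolaFinset.symm

/-- In a finite ring a one-sided inverse is two-sided, so the points of `H` are the pairs `(u,
u⁻¹)`. -/
theorem card_hyperbolaFinset : (hyperbolaFinset R).card = Nat.card Rˣ := by
  rw [Nat.card_eq_fintype_card, ← Finset.card_univ]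
  refine Finset.card_bij' (fun P hP => ⟨P.1, P.2, mem_hyperbolaFinset.1 hP,
    mul_eq_one_symm (mem_hyperbolaFinset.1 hP)⟩) (fun u _ => (u.1, u.2)) ?_ ?_ ?_ ?_
  · intro P _; exact Finset.mem_univ _
  · intro u _; exact mem_hyperbolaFinset.2 u.mul_inv
  · intro P _; rfl
  · intro u _; exact Units.ext rfl

theorem card_sq_mul_setFourierCoeff (ψ : AddChar (R × R) ℂ) :
    (Nat.card R : ℂ) ^ 2 * setFourierCoeff (hyperbola R) ψ =
      cayleyEigenvalue (hyperbolaFinset R) ψ := by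
  have hc : (Nat.card R : ℂ) ≠ 0 := Nat.cast_ne_zero.2 Nat.card_pos.ne'
  rw [coe_cayleyEigenvalue neg_mem_hyperbolaFinset, setFourierCoeff, Nat.card_prod]
  push_cast
  rw [← mul_assoc, ← pow_two, mul_inv_cancel₀ (pow_ne_zero 2 hc), one_mul, hyperbolaFinset,
    Finset.sum_filter]
  refine Finset.sum_congr rfl fun P _ => ?_
  by_cases h : P.1 * P.2 = 1
  · rw [Set.indicator_of_mem (show P ∈ hyperbola R from h), if_pos h, one_mul]
  · rw [Set.indicator_of_notMem (show P ∉ hyperbola R from h), if_neg h, zero_mul]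

theorem norm_setFourierCoeff_le_iff (C : ℝ) (ψ : AddChar (R × R) ℂ) :
    ‖setFourierCoeff (hyperbola R) ψ‖ ≤ C * ((Nat.card R : ℝ) ^ 2)⁻¹ * √(Nat.card Rˣ : ℝ) ↔
      |cayleyEigenvalue (hyperbolaFinset R) ψ| / √(Nat.card Rˣ : ℝ) ≤ C := by
  have hc : (0 : ℝ) < (Nat.card R : ℝ) ^ 2 := by
    have : (0 : ℝ) < Nat.card R := Nat.cast_pos.2 Nat.card_pos
    positivity
  have h1 := congrArg norm (card_sq_mul_setFourierCoeff ψ)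
  rw [norm_mul, norm_pow, Complex.norm_natCast, Complex.norm_real, Real.norm_eq_abs] at h1
  rw [div_le_iff₀ (sqrt_card_units_pos R), ← h1, mul_right_comm, ← div_eq_mul_inv,
    le_div_iff₀ hc, mul_comm]

variable (R) in
/-- The Kloosterman-Salem number is the normalised largest nontrivial eigenvalue. -/
theorem kloostermanSalem_spec [Nontrivial R] : 0 < kloostermanSalem R ∧
    (∀ ψ : AddChar (R × R) ℂ, ψ ≠ 1 → |cayleyEigenvalue (hyperbolaFinset R) ψ| ≤
      kloostermanSalem R * √(Nat.card Rˣ : ℝ)) ∧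
    ∃ ψ : AddChar (R × R) ℂ, ψ ≠ 1 ∧ |cayleyEigenvalue (hyperbolaFinset R) ψ| =
      kloostermanSalem R * √(Nat.card Rˣ : ℝ) := by
  classical
  have hd := sqrt_card_units_pos R
  -- The infimum runs over `C > 0`, so it is attained only once the maximum is known to be positive.
  obtain ⟨ψ₀, hψ₀, hne⟩ := exists_cayleyEigenvalue_ne_zero (S := hyperbolaFinset R)
    neg_mem_hyperbolaFinset hyperbolaFinset_nonempty (by simp [mem_hyperbolaFinset])
  obtain ⟨φ, hφ, hmax⟩ := Finset.exists_max_image (Finset.univ.erase (1 : AddChar (R × R) ℂ))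
    (fun ψ => |cayleyEigenvalue (hyperbolaFinset R) ψ|) ⟨ψ₀, by simp [hψ₀]⟩
  have hpos : 0 < |cayleyEigenvalue (hyperbolaFinset R) φ| :=
    (abs_pos.2 hne).trans_le (hmax ψ₀ (by simp [hψ₀]))
  have hk : kloostermanSalem R =
      |cayleyEigenvalue (hyperbolaFinset R) φ| / √(Nat.card Rˣ : ℝ) := by
    rw [kloostermanSalem]
    simp_rw [norm_setFourierCoeff_le_iff]
    refine IsLeast.csInf_eq ⟨⟨div_pos hpos hd, fun ψ hψ => ?_⟩, fun C hC => ?_⟩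
    · exact div_le_div_of_nonneg_right (hmax ψ (by simp [hψ])) hd.le
    · exact hC.2 φ (Finset.ne_of_mem_erase hφ)
  rw [hk, div_mul_cancel₀ _ hd.ne']
  exact ⟨div_pos hpos hd, fun ψ hψ => hmax ψ (by simp [hψ]), φ, Finset.ne_of_mem_erase hφ, rfl⟩

end Hyperbola

/-! ### Fields: eigenvalues as Kloosterman sums -/

section Field

theorem norm_sum_mulShift_ne_zero {F : Type*} [Field F] [Fintype F] [DecidableEq F]
    {χ : AddChar F ℂ} (hχ : χ ≠ 1) {a : F} (ha : a ≠ 0) :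
    ‖∑ x : F, if x = 0 then 0 else χ (a * x)‖ = 1 := by
  have h1 : ∑ x : F, χ (a * x) = 0 := by
    have := AddChar.sum_mulShift a (AddChar.IsPrimitive.of_ne_one hχ)
    simpa [ha, mul_comm] using this
  have h2 : ∑ x : F, (if x = 0 then 0 else χ (a * x)) = -1 := by
    rw [← Finset.add_sum_erase _ _ (Finset.mem_univ (0 : F))] at h1 ⊢
    rw [if_pos rfl, zero_add, Finset.sum_congr rfl fun x hx => if_neg (Finset.ne_of_mem_erase hx)]
    rw [mul_zero, AddChar.map_zero_eq_one] at h1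
    linear_combination h1
  rw [h2, norm_neg, norm_one]

/-- Every character of `F²` is `χ (a x + b y)`. If `a` and `b` are nonzero the eigenvalue is a
Kloosterman sum; if exactly one is zero it has modulus 1. -/
theorem abs_cayleyEigenvalue_hyperbola_le_of_field {F : Type*} [Field F] [Fintype F]
    [DecidableEq F] {ψ : AddChar (F × F) ℂ} (hψ : ψ ≠ 1) :
    |cayleyEigenvalue (hyperbolaFinset F) ψ| ≤ 2 * √(Fintype.card F : ℝ) := by
  obtain ⟨χ, hχ⟩ : ∃ χ : AddChar F ℂ, χ ≠ 1 := by
    obtain ⟨χ, h⟩ := AddChar.exists_apply_ne_zero.2 (one_ne_zero (α := F))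
    exact ⟨χ, AddChar.ne_one_iff.2 ⟨1, h⟩⟩
  obtain ⟨a, ha⟩ := exists_mulShift_eq hχ (ψ.compAddMonoidHom (AddMonoidHom.inl F F))
  obtain ⟨b, hb⟩ := exists_mulShift_eq hχ (ψ.compAddMonoidHom (AddMonoidHom.inr F F))
  have hψab : ∀ x y, ψ (x, y) = χ (a * x + b * y) := fun x y => by
    have h1 := DFunLike.congr_fun ha x
    have h2 := DFunLike.congr_fun hb y
    rw [AddChar.mulShift_apply, AddChar.compAddMonoidHom_apply] at h1 h2
    rw [AddChar.map_add_eq_mul, h1, h2, ← AddChar.map_add_eq_mul]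
    simp
  have hsum : (cayleyEigenvalue (hyperbolaFinset F) ψ : ℂ) =
      ∑ x : F, if x = 0 then 0 else χ (-a * x + -b / x) := by
    rw [coe_cayleyEigenvalue neg_mem_hyperbolaFinset]
    have hite : ∀ x : F, (if x = 0 then 0 else χ (-a * x + -b / x)) =
        if x ≠ 0 then χ (-a * x + -b / x) else 0 := fun x => (ite_not _ _ _).symm
    simp_rw [hite]
    rw [← Finset.sum_filter]
    refine Finset.sum_nbij' (fun P => P.1) (fun x => (x, x⁻¹)) ?_ ?_ ?_ ?_ ?_
    · intro P hP
      rw [mem_hyperbolaFinset] at hP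
      simpa using left_ne_zero_of_mul_eq_one hP
    · intro x hx
      rw [Finset.mem_filter] at hx
      exact mem_hyperbolaFinset.2 (mul_inv_cancel₀ hx.2)
    · rintro ⟨x, y⟩ hP
      rw [mem_hyperbolaFinset] at hP
      exact Prod.ext rfl (eq_inv_of_mul_eq_one_right hP).symm
    · intro x _; rfl
    · rintro ⟨x, y⟩ hP
      rw [mem_hyperbolaFinset] at hP
      have hy : y = x⁻¹ := eq_inv_of_mul_eq_one_right hP
      rw [Prod.neg_mk, hψab, hy]
      congr 1
      simp [div_eq_mul_inv]
  have hone : (1 : ℝ) ≤ 2 * √(Fintype.card F : ℝ) := by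
    have : (1 : ℝ) ≤ √(Fintype.card F : ℝ) :=
      Real.one_le_sqrt.2 (by exact_mod_cast Fintype.card_pos)
    linarith
  rw [← Real.norm_eq_abs, ← Complex.norm_real, hsum]
  by_cases ha0 : a = 0
  · have hb0 : b ≠ 0 := by
      rintro rfl
      refine hψ (AddChar.eq_one_iff.2 fun P => ?_)
      rw [← Prod.mk.eta (p := P), hψab, ha0]
      simp
    refine le_trans (le_of_eq ?_) hone
    rw [← norm_sum_mulShift_ne_zero hχ (neg_ne_zero.2 hb0)]
    congr 1
    refine Fintype.sum_equiv (Equiv.inv F) _ _ fun x => ?_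
    simp [ha0, div_eq_mul_inv]
  · by_cases hb0 : b = 0
    · refine le_trans (le_of_eq ?_) hone
      rw [← norm_sum_mulShift_ne_zero hχ (neg_ne_zero.2 ha0)]
      simp [hb0]
    · exact norm_sum_kloosterman_le hχ (neg_ne_zero.2 ha0) (neg_ne_zero.2 hb0)

theorem abs_cayleyEigenvalue_hyperbola_le {R : Type*} [Ring R] [Fintype R] [DecidableEq R]
    (hR : IsField R) {ψ : AddChar (R × R) ℂ} (hψ : ψ ≠ 1) :
    |cayleyEigenvalue (hyperbolaFinset R) ψ| ≤ 2 * √(Nat.card R : ℝ) := by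
  rw [Nat.card_eq_fintype_card]
  exact @abs_cayleyEigenvalue_hyperbola_le_of_field R hR.toField _ _ ψ hψ

theorem IsField.card_units {R : Type*} [Ring R] [Finite R] (hR : IsField R) :
    (Nat.card Rˣ : ℝ) = Nat.card R - 1 := by
  have h : Nat.card Rˣ = Nat.card R - 1 := @Nat.card_units R hR.toField.toSemifield.toCommGroupWithZero.toGroupWithZero
  rw [h, Nat.cast_sub Nat.card_pos, Nat.cast_one]

end Field

/-! ### The numerical constant and the final assembly -/

theorem sqrt_sub_one_le_of_weil {q : ℕ} (hq : 8 ≤ q) {C : ℝ} (hC : 0 < C)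
    (h : C * √((q : ℝ) - 1) ≤ 2 * √(q : ℝ)) :
    1 / 2.14 * √((q : ℝ) - 1) ≤ √((q : ℝ) - 1) / C := by
  have hq' : (8 : ℝ) ≤ q := by exact_mod_cast hq
  have hs : 0 < √((q : ℝ) - 1) := Real.sqrt_pos.2 (by linarith)
  -- Squared, this is `4 q ≤ 4.5796 (q - 1)`, which holds among integers exactly from `q = 8` on.
  have h1 : 2 * √(q : ℝ) ≤ 2.14 * √((q : ℝ) - 1) := by
    rw [← sq_le_sq₀ (by positivity) (by positivity), mul_pow, mul_pow, Real.sq_sqrt (by linarith),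
      Real.sq_sqrt (by linarith)]
    linarith
  have h2 : C ≤ 2.14 := le_of_mul_le_mul_right (h.trans h1) hs
  rw [one_div_mul_eq_div]
  exact div_le_div_of_nonneg_left hs.le hC h2

theorem theorem3 (R : Type*) [Ring R] [Nontrivial R] [Fintype R] [DecidableEq R] :
    -- regularity
    (hyperbolaGraph R).IsRegularOfDegree (Nat.card Rˣ) ∧
    -- connected and not bipartite iff not extremal
    (((hyperbolaGraph R).Connected ∧ ¬ (hyperbolaGraph R).IsBipartite) ↔
      kloostermanSalem R < √(Nat.card Rˣ : ℝ)) ∧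
    (kloostermanSalem R < √(Nat.card Rˣ : ℝ) ↔ ¬ IsExtremalRing R) ∧
    -- the spectrum, with multiplicities
    (graphSpectrum (hyperbolaGraph R)).map (fun l : ℝ => (l : ℂ)) =
      (Finset.univ : Finset (AddChar (R × R) ℂ)).val.map
        (fun ψ => (Nat.card R : ℂ) ^ 2 * setFourierCoeff (hyperbola R) ψ) ∧
    -- the spectral gap
    (¬ IsExtremalRing R →
      spectralGap (hyperbolaGraph R) =
        (Nat.card Rˣ : ℝ) - kloostermanSalem R * √(Nat.card Rˣ : ℝ)) ∧
    -- mixing of the random walk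
    (¬ IsExtremalRing R →
      ∀ i j : R × R,
        Tendsto (fun t : ℕ => walkProb (hyperbolaGraph R) t i j) atTop
          (𝓝 (1 / (Nat.card R : ℝ) ^ 2)) ∧
        ∀ t : ℕ, |walkProb (hyperbolaGraph R) t i j - 1 / (Nat.card R : ℝ) ^ 2| ≤
          (kloostermanSalem R / √(Nat.card Rˣ : ℝ)) ^ t) ∧
    -- the independence number
    ((hyperbolaGraph R).indepNum : ℝ) ≤
      kloostermanSalem R * (Nat.card R : ℝ) ^ 2 / √(Nat.card Rˣ : ℝ) ∧
    -- the chromatic number, for all rings and for fields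
    ∃ k : ℕ, (hyperbolaGraph R).chromaticNumber = (k : ℕ∞) ∧
      √(Nat.card Rˣ : ℝ) / kloostermanSalem R ≤ (k : ℝ) ∧
      (IsField R → 1 / 2.14 * √((Nat.card R : ℝ) - 1) ≤ (k : ℝ)) := by
  have hS := neg_mem_hyperbolaFinset (R := R)
  have hS0 := hyperbolaFinset_nonempty (R := R)
  have hG := hyperbolaGraph_adj_iff (R := R)
  have hd := card_hyperbolaFinset (R := R)
  obtain ⟨hC, hle, φ, hφ, hφeq⟩ := kloostermanSalem_spec R
  have hs := sqrt_card_units_pos R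
  have hss : √(Nat.card Rˣ : ℝ) * √(Nat.card Rˣ : ℝ) = Nat.card Rˣ :=
    Real.mul_self_sqrt (Nat.cast_nonneg _)
  have hd' : ((hyperbolaFinset R).card : ℝ) = √(Nat.card Rˣ : ℝ) * √(Nat.card Rˣ : ℝ) := by
    rw [hd, hss]
  have hcard : (Fintype.card (R × R) : ℝ) = (Nat.card R : ℝ) ^ 2 := by
    rw [Fintype.card_prod, Nat.card_eq_fintype_card]; push_cast; ring
  have hn : (0 : ℝ) < (Nat.card R : ℝ) ^ 2 := by rw [← hcard]; exact_mod_cast Fintype.card_pos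
  have hCle : kloostermanSalem R ≤ √(Nat.card Rˣ : ℝ) := by
    have := abs_cayleyEigenvalue_le (S := hyperbolaFinset R) φ
    rw [hφeq, hd'] at this
    exact le_of_mul_le_mul_right this hs
  have hlt_iff : kloostermanSalem R < √(Nat.card Rˣ : ℝ) ↔ ¬ IsExtremalRing R :=
    ⟨fun h => h.ne, fun h => lt_of_le_of_ne hCle h⟩
  have hdiv : kloostermanSalem R * √(Nat.card Rˣ : ℝ) / (hyperbolaFinset R).card =
      kloostermanSalem R / √(Nat.card Rˣ : ℝ) := by
    rw [hd', mul_div_mul_right _ _ hs.ne']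
  have hwalk := fun t i j =>
    abs_walkProb_sub_le hS hG hS0 hle (mul_nonneg hC.le hs.le) t i j
  simp_rw [hcard, hdiv] at hwalk
  have hind : ((hyperbolaGraph R).indepNum : ℝ) ≤
      kloostermanSalem R * (Nat.card R : ℝ) ^ 2 / √(Nat.card Rˣ : ℝ) := by
    obtain ⟨T, hT⟩ := (hyperbolaGraph R).exists_isNIndepSet_indepNum
    have hT' : ∀ x ∈ T, ∀ y ∈ T, x - y ∉ hyperbolaFinset R := fun x hx y hy hxy => by
      have hadj := (hG x y).2 hxy
      exact hT.isIndepSet hx hy hadj.ne hadj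
    have h := card_mul_card_le_of_indep hS hle (mul_nonneg hC.le hs.le) hT'
    rw [hT.card_eq, hcard, hd'] at h
    rw [le_div_iff₀ hs]
    refine le_of_mul_le_mul_left ?_ hs
    linarith
  refine ⟨fun x => by rw [degree_cayley hG, hd], ?_, hlt_iff, ?_, fun _ => ?_, fun hex i j => ?_,
    hind, ?_⟩
  · rw [connected_and_not_bipartite_iff hS hG hS0, hd']
    constructor
    · intro h
      have := h φ hφ
      rw [hφeq] at this
      exact lt_of_mul_lt_mul_right this hs.le
    · exact fun h ψ hψ => (hle ψ hψ).trans_lt (mul_lt_mul_of_pos_right h hs)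
  · rw [graphSpectrum_cayley hS hG, Multiset.map_map]
    exact Multiset.map_congr rfl fun ψ _ => (card_sq_mul_setFourierCoeff ψ).symm
  · rw [spectralGap_cayley hS hG hle ⟨φ, hφ, hφeq⟩, hd]
  · refine ⟨?_, fun t => hwalk t i j⟩
    rw [tendsto_iff_norm_sub_tendsto_zero]
    refine squeeze_zero (fun _ => norm_nonneg _) (fun t => hwalk t i j)
      (tendsto_pow_atTop_nhds_zero_of_lt_one (div_nonneg hC.le hs.le) ?_)
    exact (div_lt_one hs).2 (hlt_iff.2 hex)
  · obtain ⟨k, hk⟩ := ENat.ne_top_iff_exists.1 (SimpleGraph.chromaticNumber_ne_top_iff_exists.2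
      ⟨_, (hyperbolaGraph R).colorable_of_fintype⟩)
    have hcol : (hyperbolaGraph R).Colorable k :=
      SimpleGraph.chromaticNumber_le_iff_colorable.1 hk.ge
    have hbound : √(Nat.card Rˣ : ℝ) / kloostermanSalem R ≤ (k : ℝ) := by
      have h1 : (Fintype.card (R × R) : ℝ) ≤ k * (hyperbolaGraph R).indepNum := by
        exact_mod_cast card_le_mul_indepNum hcol
      rw [hcard] at h1
      have h2 := h1.trans (mul_le_mul_of_nonneg_left hind (Nat.cast_nonneg k))
      rw [← mul_div_assoc, le_div_iff₀ hs] at h2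
      rw [div_le_iff₀ hC]
      refine le_of_mul_le_mul_left ?_ hn
      linarith
    refine ⟨k, hk.symm, hbound, fun hF => ?_⟩
    have hunits := hF.card_units
    have hk2 : (2 : ℝ) ≤ k := by
      have hadj : (hyperbolaGraph R).Adj (1, 1) 0 :=
        (hG _ _).2 (mem_hyperbolaFinset.2 (by simp))
      have := SimpleGraph.two_le_chromaticNumber_of_adj hadj
      rw [← hk] at this
      exact_mod_cast this
    by_cases hq : 8 ≤ Nat.card R
    · have hweil := abs_cayleyEigenvalue_hyperbola_le hF hφ
      rw [hφeq, hunits] at hweil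
      rw [hunits] at hbound
      exact (sqrt_sub_one_le_of_weil hq hC hweil).trans hbound
    -- For `q ≤ 7` the constant is too tight for Weil's bound, but the graph has an edge and two
    -- colours already exceed the claim.
    · have hq7 : (Nat.card R : ℝ) ≤ 7 := by exact_mod_cast (by omega : Nat.card R ≤ 7)
      have : √((Nat.card R : ℝ) - 1) ≤ 4 := by
        rw [Real.sqrt_le_left (by norm_num)]
        linarith
      refine le_trans ?_ hk2
      calc 1 / 2.14 * √((Nat.card R : ℝ) - 1) ≤ 1 / 2.14 * 4 := by gcongr
        _ ≤ 2 := by norm_num
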